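/- Let $N\ge 1$, let $\mathbb K$ be a field of characteristic $0$ and let $q,s\in\mathbb K$ be algebraically independent over $\mathbb Q$ (for instance $\mathbb K=\mathbb C(q,s)$). All operators act on the right, so that $AB$ means first $A$, then $B$. **The module $V_\lambda$.** Let $\lambda$ be a partition of $N$. A reverse standard tableau (RST) $\mathbb T$ of shape $\lambda$ is a filling of the shape by $1,\dots,N$, each used once, strictly decreasing along rows and columns; cells have a row and a column index, row $1$ being the longest. ${\rm CT}_{\mathbb T}[i]={\rm COL}_{\mathbb T}[i]-{\rm ROW}_{\mathbb T}[i]$ is the content of the entry $i$, and $\mathbb T^{(i,j)}$ is the filling obtained by exchanging $i$ and $j$. $V_\lambda$ is the $\mathbb K$-vector space with basis the RST of shape $\lambda$, on which $T_1,\dots,T_{N-1}$ act by: $\mathbb T T_i=s\mathbb T$ if $i,i+1$ are in the same row; $\mathbb T T_i=-\mathbb T$ if they are in the same column; otherwise, with $m={\rm CT}_{\mathbb T}[i+1]-{\rm CT}_{\mathbb T}[i]$, $$\mathbb T T_i=\mathbb T^{(i,i+1)}-\tfrac{1-s}{1-s^{m}}\mathbb T\quad\text{if } {\rm ROW}_{\mathbb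 T}[i]<{\rm ROW}_{\mathbb T}[i+1],$$ $$\mathbb T T_i=\tfrac{s-1}{1-s^m}\mathbb T+\tfrac{s(1-s^{m+1})(1-s^{m-1})}{(1-s^m)^2}\mathbb T^{(i,i+1)}\quad\text{if } {\rm ROW}_{\mathbb T}[i]>{\rm ROW}_{\mathbb T}[i+1].$$ Moreover $T_i^{-1}=\frac1s(T_i+1-s)$. **Vector valued polynomials.** Let $\mathcal M_\lambda=\mathbb K[x_1,\dots,x_N]\otimes V_\lambda$. Let $s_i^x$ exchange $x_i$ and $x_{i+1}$ and put $f\delta_i^x=(1-s)\,x_{i+1}\frac{f-fs_i^x}{x_i-x_{i+1}}$. On $\mathcal M_\lambda$ set ${\bf T}_i=\delta_i^x+s_i^xT_i$, ${\bf T}_i^{-1}=\frac1s({\bf T}_i+1-s)$ and ${\bf \Phi}={\bf T}_1^{-1}\cdots{\bf T}_{N-1}^{-1}x_N$. **Macdonald polynomials.** Consider 4-tuples $(\mathbb T,\zeta,v,\sigma)$ with $\mathbb T$ an RST of shape $\lambda$, $\zeta\in\mathbb K^N$, $v\in\mathbb N^N$, $\sigma\in\mathfrak S_N$; for a vector (or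 a permutation in one-line notation) $a$, let $as_i$ be $a$ with $a[i]$ and $a[i+1]$ exchanged. The root is $(\mathbb T_\lambda,(s^{{\rm CT}_{\mathbb T_\lambda}[i]})_i,0^N,{\rm id})$, where $\mathbb T_\lambda$ contains $N,N-1,\dots,1$ in this order when the columns are read from left to right, each starting in row $1$. To the root one attaches the polynomial $\mathbb T_\lambda=1\otimes\mathbb T_\lambda$. From a 4-tuple $(\mathbb T,\zeta,v,\sigma)$ with attached polynomial $P$ one may pass * if $v[i]<v[i+1]$, to $(\mathbb T,\zeta s_i,vs_i,\sigma s_i)$; * if $v[i]=v[i+1]$, $\sigma[i]<\sigma[i+1]$, ${\rm CT}_{\mathbb T}[\sigma[i]]\ge{\rm CT}_{\mathbb T}[\sigma[i+1]]+2$ and $\mathbb T^{(\sigma[i],\sigma[i+1])}$ is an RST, to $(\mathbb T^{(\sigma[i],\sigma[i+1])},\zeta s_i,v,\sigma)$; * to $(\mathbb T,[\zeta[2],\dots,\zeta[N],q\zeta[1]],[v[2],\dots,v[N],v[1]+1],[\sigma[2],\dots,\sigma[N],\sigma[1]])$; in the first two cases the new polynomial is $P\left({\bf T}_i+\frac{1-s}{1-\zeta[i+1]/\zeta[i]}\right)$,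 in the third it is $P{\bf \Phi}$. The polynomial obtained along a path of such moves from the root to a 4-tuple with first entry $\mathbb T$ and third entry $v$ is the Macdonald polynomial $P_{v,\mathbb T}$. **Monomials and their order.** For $v\in\mathbb N^N$ the rank permutation is $$r_v[i]=\#\{j\le i: v[j]\ge v[i]\}+\#\{j>i: v[j]>v[i]\}.$$ If $r_v=s_{i_1}\cdots s_{i_\ell}$ is a shortest expression (permutations acting on the right), put $R_v=T_{i_\ell}^{-1}\cdots T_{i_1}^{-1}$ and $x^{v,\mathbb T}=x^v\,\mathbb T R_v$. Write $a\prec b$ if $a[1]+\dots+a[i]\le b[1]+\dots+b[i]$ for $1\le i\le N$, and let $v^+$ be the decreasing rearrangement of $v$. Then $v\lhd v'$ means that $v\ne v'$ and that $v^+\prec v'^+$ if $v^+\neq v'^+$, respectively $v\prec v'$ if $v^+=v'^+$; and $x^{v,\mathbb T}\lhd x^{v',\mathbb T'}$ means $v\lhd v'$. **Theorem.** For every partition $\lambda$ of $N$, every RST $\mathbb T$ of shape $\lambda$ and every $v\in\mathbb N^N$, such a path exists, and for every such path the polynomial $P_{v,\mathbb T}$ obtained along it has leading term $x^{v,\mathbb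 T}$ up to a nonzero constant: there is $c\in\mathbb K$, $c\neq0$, such that $P_{v,\mathbb T}-c\,x^{v,\mathbb T}$ is a linear combination of monomials $x^{v',\mathbb T'}$ with $v'\lhd v$. -/

import Mathlib

/-!
Vector-valued nonsymmetric Macdonald polynomials of isotype `μ`, a partition of `N = n + 1`.

All indices are shifted by one: the positions and tableau entries `1, …, N` of the usual notation
are the elements of `Fin (n + 1)`, and the generator indices `1, …, N - 1` are those of `Fin n`; the
generator with index `i` exchanges the positions `i.castSucc` and `i.succ`.
Operators act on the right: a product `A B` means first `A`, then `B`.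
-/

noncomputable section

namespace VVMacdonald

open MvPolynomial
open scoped TensorProduct

/-- The simple transposition `s_i`. -/
def simple {n : ℕ} (i : Fin n) : Equiv.Perm (Fin (n + 1)) := Equiv.swap i.castSucc i.succ

/-! ### Reverse standard tableaux -/

/-- A filling of the cells of `μ` with each of the entries once is reverse standard if the entries
strictly decrease along every row and every column. A cell is a pair `(row, column)`. -/
def IsRST {μ : YoungDiagram} {n : ℕ} (f : {c // c ∈ μ.cells} ≃ Fin (n + 1)) : Prop :=
  (∀ c d, c.1.1 = d.1.1 → c.1.2 < d.1.2 → f d < f c) ∧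
  (∀ c d, c.1.2 = d.1.2 → c.1.1 < d.1.1 → f d < f c)

/-- Reverse standard tableaux of shape `μ`. -/
def RST (μ : YoungDiagram) (n : ℕ) : Type :=
  {f : {c // c ∈ μ.cells} ≃ Fin (n + 1) // IsRST f}

namespace RST

variable {μ : YoungDiagram} {n : ℕ}

/-- The row of the entry `k`. -/
def row (T : RST μ n) (k : Fin (n + 1)) : ℕ := (T.1.symm k).1.1

/-- The column of the entry `k`. -/
def col (T : RST μ n) (k : Fin (n + 1)) : ℕ := (T.1.symm k).1.2

/-- The content (column minus row) of the entry `k`. -/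
def content (T : RST μ n) (k : Fin (n + 1)) : ℤ := (T.col k : ℤ) - (T.row k : ℤ)

/-- The filling obtained by exchanging the entries `k` and `l`. -/
def swapFilling (T : RST μ n) (k l : Fin (n + 1)) : {c // c ∈ μ.cells} ≃ Fin (n + 1) :=
  T.1.trans (Equiv.swap k l)

theorem simple_lt {i : Fin n} {a b : Fin (n + 1)} (hab : a < b)
    (h : ¬ (a = i.castSucc ∧ b = i.succ)) : simple i a < simple i b := by
  unfold simple
  rw [Equiv.swap_apply_def, Equiv.swap_apply_def]
  rw [Fin.lt_def] at hab ⊢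
  simp only [Fin.ext_iff, Fin.val_castSucc, Fin.val_succ] at h ⊢
  split_ifs <;> (try simp only [Fin.val_castSucc, Fin.val_succ]) <;> omega

/-- Exchanging consecutive entries that lie in different rows and columns gives again a reverse
standard tableau. -/
theorem isRST_swapFilling (T : RST μ n) (i : Fin n)
    (hr : T.row i.castSucc ≠ T.row i.succ) (hc : T.col i.castSucc ≠ T.col i.succ) :
    IsRST (T.swapFilling i.castSucc i.succ) := by
  refine ⟨fun c d h1 h2 => ?_, fun c d h1 h2 => ?_⟩
  · refine simple_lt (T.2.1 c d h1 h2) fun h => hr ?_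
    simp only [row, ← h.1, ← h.2, Equiv.symm_apply_apply, h1]
  · refine simple_lt (T.2.2 c d h1 h2) fun h => hc ?_
    simp only [col, ← h.1, ← h.2, Equiv.symm_apply_apply, h1]

/-- The root tableau: the entries decrease when the columns are read one after the other from left
to right, each column starting in its first (longest) row. -/
def IsRoot (T : RST μ n) : Prop :=
  ∀ c d, T.1 d < T.1 c ↔ c.1.2 < d.1.2 ∨ (c.1.2 = d.1.2 ∧ c.1.1 < d.1.1)

end RST

/-! ### The Hecke algebra module `V_μ` -/

section Module

variable {K : Type*} [Field K] {μ : YoungDiagram} {n : ℕ}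

/-- The vector space with basis the reverse standard tableaux of shape `μ`. -/
abbrev V (K : Type*) [Field K] (μ : YoungDiagram) (n : ℕ) : Type _ := RST μ n →₀ K

open Classical in
/-- The vector `𝕋 T_i`, for a tableau `𝕋`. -/
def tableauT (s : K) (i : Fin n) (T : RST μ n) : V K μ n :=
  if hr : T.row i.castSucc = T.row i.succ then s • Finsupp.single T 1
  else if hc : T.col i.castSucc = T.col i.succ then - Finsupp.single T 1
  else
    let T' : RST μ n := ⟨T.swapFilling i.castSucc i.succ, T.isRST_swapFilling i hr hc⟩
    let m : ℤ := T.content i.succ - T.content i.castSucc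
    if T.row i.castSucc < T.row i.succ then
      Finsupp.single T' 1 - ((1 - s) / (1 - s ^ m)) • Finsupp.single T 1
    else
      ((s - 1) / (1 - s ^ m)) • Finsupp.single T 1
        + (s * (1 - s ^ (m + 1)) * (1 - s ^ (m - 1)) / (1 - s ^ m) ^ 2) • Finsupp.single T' 1

/-- The action of the Hecke algebra generator `T_i` on `V_μ`. -/
def heckeT (μ : YoungDiagram) (s : K) (i : Fin n) : V K μ n →ₗ[K] V K μ n :=
  Finsupp.linearCombination K (tableauT s i)

/-- The action of `T_i⁻¹ = s⁻¹ (T_i + 1 - s)` on `V_μ`. -/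
def heckeTInv (μ : YoungDiagram) (s : K) (i : Fin n) : V K μ n →ₗ[K] V K μ n :=
  s⁻¹ • (heckeT μ s i + (1 - s) • LinearMap.id)

end Module

/-! ### The rank permutation and its inverse Hecke element -/

section Rank

variable {n : ℕ}

/-- The value of the rank function of `v` at `i` (counted from `0`). -/
def rankNat (v : Fin (n + 1) → ℕ) (i : Fin (n + 1)) : ℕ :=
  (Finset.univ.filter fun j => j < i ∧ v i ≤ v j).card
    + (Finset.univ.filter fun j => i < j ∧ v i < v j).card

theorem rankNat_eq (v : Fin (n + 1) → ℕ) (i : Fin (n + 1)) :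
    rankNat v i =
      (Finset.univ.filter fun j => (j < i ∧ v i ≤ v j) ∨ (i < j ∧ v i < v j)).card := by
  rw [Finset.filter_or, Finset.card_union_of_disjoint]
  · rfl
  · rw [Finset.disjoint_filter]
    intro j _ h h'
    exact absurd h.1 (not_lt.mpr h'.1.le)

theorem rankNat_lt (v : Fin (n + 1) → ℕ) (i : Fin (n + 1)) : rankNat v i < n + 1 := by
  rw [rankNat_eq]
  calc _ < (Finset.univ : Finset (Fin (n + 1))).card := by
        apply Finset.card_lt_card
        rw [Finset.ssubset_univ_iff]
        intro h
        have := h ▸ Finset.mem_univ i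
        simp at this
    _ = n + 1 := by simp

theorem rankNat_lt_of (v : Fin (n + 1) → ℕ) {i k : Fin (n + 1)}
    (h : (k < i ∧ v i ≤ v k) ∨ (i < k ∧ v i < v k)) : rankNat v k < rankNat v i := by
  rw [rankNat_eq, rankNat_eq]
  apply Finset.card_lt_card
  rw [Finset.ssubset_iff_of_subset]
  · exact ⟨k, by simpa using h, by simp⟩
  · intro j hj
    simp only [Finset.mem_filter, Finset.mem_univ, true_and] at hj ⊢
    rcases lt_trichotomy j i with hji | hji | hji
    · exact Or.inl ⟨hji, by omega⟩
    · subst hji; omega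
    · exact Or.inr ⟨hji, by omega⟩

/-- The rank permutation `r_v`. -/
def rankPerm (v : Fin (n + 1) → ℕ) : Equiv.Perm (Fin (n + 1)) :=
  Equiv.ofBijective (fun i => ⟨rankNat v i, rankNat_lt v i⟩) <| by
    rw [← Finite.injective_iff_bijective]
    intro i k h
    have h' : rankNat v i = rankNat v k := by simpa using h
    by_contra hne
    rcases lt_or_gt_of_ne hne with hik | hik
    · rcases lt_or_ge (v i) (v k) with hv | hv
      · have := rankNat_lt_of v (i := i) (k := k) (Or.inr ⟨hik, hv⟩); omega
      · have := rankNat_lt_of v (i := k) (k := i) (Or.inl ⟨hik, hv⟩); omega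
    · rcases lt_or_ge (v k) (v i) with hv | hv
      · have := rankNat_lt_of v (i := k) (k := i) (Or.inr ⟨hik, hv⟩); omega
      · have := rankNat_lt_of v (i := i) (k := k) (Or.inl ⟨hik, hv⟩); omega

/-- The word `w = [i₁, …, i_l]` represents the product `s_{i₁} ⋯ s_{i_l}` of permutations acting on
the right (so `s_{i₁}` is applied first). -/
def wordPerm (w : List (Fin n)) : Equiv.Perm (Fin (n + 1)) :=
  (w.map simple).reverse.prod

/-- `w` is a shortest expression of `σ`. -/
def IsShortest (w : List (Fin n)) (σ : Equiv.Perm (Fin (n + 1))) : Prop :=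
  wordPerm w = σ ∧ ∀ w', wordPerm w' = σ → w.length ≤ w'.length

theorem exists_shortest (σ : Equiv.Perm (Fin (n + 1))) : ∃ w : List (Fin n), IsShortest w σ := by
  have hex : ∃ w : List (Fin n), wordPerm w = σ := by
    have hσ : σ ∈ Submonoid.closure
        (Set.range fun i : Fin n => Equiv.swap i.castSucc i.succ) := by
      rw [Equiv.Perm.mclosure_swap_castSucc_succ]; trivial
    induction hσ using Submonoid.closure_induction with
    | mem x hx =>
      obtain ⟨i, rfl⟩ := hx
      exact ⟨[i], by simp [wordPerm, simple]⟩
    | one => exact ⟨[], by simp [wordPerm]⟩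
    | mul x y _ _ hx hy =>
      obtain ⟨a, rfl⟩ := hx
      obtain ⟨b, rfl⟩ := hy
      exact ⟨b ++ a, by simp [wordPerm]⟩
  obtain ⟨w, hw, hmin⟩ := exists_minimalFor_of_wellFoundedLT
    (fun w : List (Fin n) => wordPerm w = σ) List.length hex
  exact ⟨w, hw, fun w' hw' => (le_total _ _).elim id fun h => hmin hw' h⟩

/-- A shortest expression of `σ`. -/
def shortestWord (σ : Equiv.Perm (Fin (n + 1))) : List (Fin n) :=
  Classical.choose (exists_shortest σ)

/-- The vector `u T_{i_l}⁻¹ ⋯ T_{i₁}⁻¹` for `w = [i₁, …, i_l]`, i.e. `u` acted upon by the inverse of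
`T_{i₁} ⋯ T_{i_l}`. -/
def heckeWordInv {K : Type*} [Field K] {μ : YoungDiagram} (s : K) (w : List (Fin n))
    (u : V K μ n) : V K μ n :=
  w.foldr (fun i x => heckeTInv μ s i x) u

/-- The vector `u R_v`, where `R_v` is the inverse of the Hecke element of the permutation `r_v`. -/
def heckeR {K : Type*} [Field K] {μ : YoungDiagram} (s : K) (v : Fin (n + 1) → ℕ)
    (u : V K μ n) : V K μ n :=
  heckeWordInv s (shortestWord (rankPerm v)) u

end Rank

/-! ### Operators on vector valued polynomials -/

section Operators

variable {K : Type*} [Field K] {n : ℕ}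

/-- `s_i^x`, the exchange of the variables `x_i` and `x_{i+1}`. -/
def varSwap (i : Fin n) :
    MvPolynomial (Fin (n + 1)) K →ₐ[K] MvPolynomial (Fin (n + 1)) K :=
  rename (simple i)

theorem dvd_sub_varSwap (i : Fin n) (f : MvPolynomial (Fin (n + 1)) K) :
    (X i.castSucc - X i.succ : MvPolynomial (Fin (n + 1)) K) ∣ f - varSwap i f := by
  induction f using MvPolynomial.induction_on with
  | C a => simp [varSwap]
  | add f g hf hg =>
    have : f + g - varSwap i (f + g) = (f - varSwap i f) + (g - varSwap i g) := by
      rw [map_add]; ring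
    rw [this]; exact dvd_add hf hg
  | mul_X f k hf =>
    have : f * X k - varSwap i (f * X k)
        = (f - varSwap i f) * X k + varSwap i f * (X k - varSwap i (X k)) := by
      rw [map_mul]; ring
    rw [this]
    refine dvd_add (hf.mul_right _) (Dvd.dvd.mul_left ?_ _)
    simp only [varSwap, rename_X, simple, Equiv.swap_apply_def]
    split_ifs with h1 h2
    · subst h1; exact dvd_rfl
    · subst h2; exact (dvd_neg.mpr dvd_rfl).trans (by rw [neg_sub])
    · simp

theorem X_sub_X_ne_zero (i : Fin n) :
    (X i.castSucc - X i.succ : MvPolynomial (Fin (n + 1)) K) ≠ 0 := by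
  rw [sub_ne_zero]
  intro h
  have := X_injective h
  simp [Fin.ext_iff] at this

/-- The divided difference `∂_i`: the polynomial `(f - f s_i) / (x_i - x_{i+1})`. -/
def dividedDiffFun (i : Fin n) (f : MvPolynomial (Fin (n + 1)) K) :
    MvPolynomial (Fin (n + 1)) K :=
  Classical.choose (dvd_sub_varSwap i f)

theorem dividedDiffFun_spec (i : Fin n) (f : MvPolynomial (Fin (n + 1)) K) :
    (X i.castSucc - X i.succ) * dividedDiffFun i f = f - varSwap i f :=
  (Classical.choose_spec (dvd_sub_varSwap i f)).symm

/-- The divided difference `∂_i` as a linear map. -/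
def dividedDiff (i : Fin n) :
    MvPolynomial (Fin (n + 1)) K →ₗ[K] MvPolynomial (Fin (n + 1)) K where
  toFun := dividedDiffFun i
  map_add' f g := by
    apply mul_left_cancel₀ (X_sub_X_ne_zero (K := K) i)
    rw [mul_add, dividedDiffFun_spec, dividedDiffFun_spec, dividedDiffFun_spec, map_add]
    ring
  map_smul' a f := by
    apply mul_left_cancel₀ (X_sub_X_ne_zero (K := K) i)
    rw [RingHom.id_apply, mul_smul_comm, dividedDiffFun_spec, dividedDiffFun_spec, map_smul,
      smul_sub]

/-- `δ_i^x`: the operator `∂_i` followed by multiplication by `(1 - s) x_{i+1}`. -/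
def delta (s : K) (i : Fin n) :
    MvPolynomial (Fin (n + 1)) K →ₗ[K] MvPolynomial (Fin (n + 1)) K :=
  (1 - s) • (LinearMap.mulLeft K (X i.succ) ∘ₗ dividedDiff i)

/-- The space `K[x_1, …, x_N] ⊗ V_μ` of vector valued polynomials. -/
abbrev M (K : Type*) [Field K] (μ : YoungDiagram) (n : ℕ) : Type _ :=
  MvPolynomial (Fin (n + 1)) K ⊗[K] V K μ n

variable (μ : YoungDiagram)

/-- The operator `𝐓_i = δ_i^x + s_i^x T_i` on vector valued polynomials. -/
def boldT (s : K) (i : Fin n) : M K μ n →ₗ[K] M K μ n :=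
  TensorProduct.map (delta s i) LinearMap.id
    + TensorProduct.map (varSwap i).toLinearMap (heckeT μ s i)

/-- The operator `𝐓_i⁻¹ = s⁻¹ (𝐓_i + 1 - s)`. -/
def boldTInv (s : K) (i : Fin n) : M K μ n →ₗ[K] M K μ n :=
  s⁻¹ • (boldT μ s i + (1 - s) • LinearMap.id)

/-- The raising operator `Φ = 𝐓_1⁻¹ ⋯ 𝐓_{N-1}⁻¹ x_N` (`𝐓_1⁻¹` is applied first, the multiplication
by `x_N` last). -/
def raising (s : K) (P : M K μ n) : M K μ n :=
  TensorProduct.map (LinearMap.mulLeft K (X (Fin.last n))) LinearMap.id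
    ((List.finRange n).foldl (fun Q i => boldTInv μ s i Q) P)

end Operators

/-! ### The Yang-Baxter graph and the Macdonald polynomials -/

section Graph

variable {K : Type*} [Field K] {μ : YoungDiagram} {n : ℕ}

/-- The labels `(𝕋, ζ, v, σ)` of the vertices of the Yang-Baxter graph. -/
structure Vertex (K : Type*) (μ : YoungDiagram) (n : ℕ) where
  /-- the tableau -/
  T : RST μ n
  /-- the spectral vector -/
  ζ : Fin (n + 1) → K
  /-- the multi-index -/
  v : Fin (n + 1) → ℕ
  /-- the permutation -/
  σ : Equiv.Perm (Fin (n + 1))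

/-- `[a_1, …, a_N] ↦ [a_2, …, a_N, b]`. -/
def shift {α : Type*} (a : Fin (n + 1) → α) (b : α) : Fin (n + 1) → α :=
  Fin.snoc (α := fun _ => α) (fun i : Fin n => a i.succ) b

/-- The operator attached to an edge labelled `s_i` that starts at a vertex with spectral vector
`ζ`. -/
def edgeOp (s : K) (ζ : Fin (n + 1) → K) (i : Fin n) (P : M K μ n) : M K μ n :=
  boldT μ s i P + ((1 - s) / (1 - ζ i.succ / ζ i.castSucc)) • P

/-- `PathPolynomial q s A P` means that some path without fall in the Yang-Baxter graph leads from
the root to the vertex `A`, and that `P` is the polynomial computed along this path. -/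
inductive PathPolynomial (q s : K) : Vertex K μ n → M K μ n → Prop
  /-- the empty path, which ends at the root -/
  | root (T : RST μ n) (hT : T.IsRoot) :
      PathPolynomial q s ⟨T, fun i => s ^ T.content i, fun _ => 0, 1⟩
        (1 ⊗ₜ[K] Finsupp.single T 1)
  /-- a non-affine step `s_i` -/
  | step (A : Vertex K μ n) (P : M K μ n) (hP : PathPolynomial q s A P) (i : Fin n)
      (hv : A.v i.castSucc < A.v i.succ) :
      PathPolynomial q s ⟨A.T, A.ζ ∘ simple i, A.v ∘ simple i, A.σ * simple i⟩
        (edgeOp s A.ζ i P)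
  /-- a correct jump `s_i`, which exchanges two entries of the tableau, the smaller of which is to
  the south-east of the larger -/
  | jump (A : Vertex K μ n) (P : M K μ n) (hP : PathPolynomial q s A P) (i : Fin n)
      (hv : A.v i.castSucc = A.v i.succ)
      (hlt : A.σ i.castSucc < A.σ i.succ)
      (hse : A.T.content (A.σ i.succ) + 2 ≤ A.T.content (A.σ i.castSucc))
      (T' : RST μ n) (hT' : T'.1 = A.T.swapFilling (A.σ i.castSucc) (A.σ i.succ)) :
      PathPolynomial q s ⟨T', A.ζ ∘ simple i, A.v, A.σ⟩ (edgeOp s A.ζ i P)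
  /-- an affine step `Ψ` -/
  | affine (A : Vertex K μ n) (P : M K μ n) (hP : PathPolynomial q s A P) :
      PathPolynomial q s
        ⟨A.T, shift A.ζ (q * A.ζ 0), shift A.v (A.v 0 + 1), A.σ * finRotate (n + 1)⟩
        (raising μ s P)

/-- `P` is the Macdonald polynomial `P_{v,𝕋}`: the polynomial computed along a path without fall
from the root to the vertex of the Yang-Baxter graph that is labelled by `𝕋` and `v`. -/
def IsMacdonald (q s : K) (v : Fin (n + 1) → ℕ) (T : RST μ n) (P : M K μ n) : Prop :=
  ∃ ζ σ, PathPolynomial q s ⟨T, ζ, v, σ⟩ P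

end Graph

/-! ### The order on monomials and leading terms -/

section Leading

variable {n : ℕ}

/-- `v ≺ v'`: every partial sum of `v` is at most the corresponding one of `v'`. -/
def DomLE (v v' : Fin (n + 1) → ℕ) : Prop :=
  ∀ i, ∑ j ∈ Finset.Iic i, v j ≤ ∑ j ∈ Finset.Iic i, v' j

/-- `v⁺`, the decreasing rearrangement of `v`. -/
def decr (v : Fin (n + 1) → ℕ) : Fin (n + 1) → ℕ := fun i => v (Tuple.sort v (Fin.rev i))

/-- `v ⊴ v'`. -/
def VecLE (v v' : Fin (n + 1) → ℕ) : Prop :=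
  (decr v ≠ decr v' → DomLE (decr v) (decr v')) ∧ (decr v = decr v' → DomLE v v')

/-- `v ◁ v'`. -/
def VecLT (v v' : Fin (n + 1) → ℕ) : Prop := v ≠ v' ∧ VecLE v v'

variable {K : Type*} [Field K] {μ : YoungDiagram}

/-- The monomial `x^{v,𝕋} = x^v 𝕋 R_v`. -/
def vvMonomial (s : K) (v : Fin (n + 1) → ℕ) (T : RST μ n) : M K μ n :=
  monomial (Finsupp.equivFunOnFinite.symm v) (1 : K) ⊗ₜ[K] heckeR s v (Finsupp.single T 1)

/-- Up to a nonzero scalar, the leading term of `P` is `x^{v,𝕋}`: `P` is the sum of a nonzero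
multiple of `x^{v,𝕋}` and of a linear combination of smaller monomials, where
`x^{v',𝕋'} ◁ x^{v,𝕋}` if and only if `v' ◁ v`. -/
def HasLeadingMonomial (s : K) (P : M K μ n) (v : Fin (n + 1) → ℕ) (T : RST μ n) : Prop :=
  ∃ c : K, c ≠ 0 ∧
    P - c • vvMonomial s v T ∈
      Submodule.span K {m | ∃ (v' : Fin (n + 1) → ℕ) (T' : RST μ n),
        VecLT v' v ∧ m = vvMonomial s v' T'}

end Leading

end VVMacdonald

end

/-!
Why the leading term of `P_{v,𝕋}` is `x^{v,𝕋}`.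

The order `VecLT` of the statement is not preserved by the moves of the graph: `v' ◁ v` and `v_i <
v_{i+1}` do not imply `v' s_i ◁ v s_i`, and an affine step may turn vectors with different
decreasing rearrangements into vectors with the same one. The induction along a path is therefore
carried out for a finer order, which every move preserves. Draw a vector `v` as an arrangement of
beads, with `v_j` beads at the bottom of column `j` of a grid, and read the grid row by row from the
top. Then `BeadLE v' v` says that, after every position of the reading order, `v'` has at most as
many beads as `v`; this is the Bruhat order of the affine symmetric group modulo the finite one. A
move `s_i` exchanges neighbouring columns, and the one bead count per row of `max(v, v s_i)` that
may differ from that of `v` is a minimum of two other bead counts (`beadCount_sortPair_eq_min`), so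
it is monotone (`BeadLE.sortPair`). The affine move shifts the reading order by one place
(`BeadLE.affineShift`). Counting beads above the rows gives `∑ (v_j - k)⁺` and hence the dominance
order of decreasing rearrangements, and inside one rearrangement class one gets the dominance order
of the vectors themselves (`BeadLT.vecLT`).

On monomials, `𝐓_i` takes `x^v ⊗ u` with `v_i ≤ v_{i+1}` to `x^{v s_i} ⊗ u T_i` plus a multiple of
`x^v ⊗ u` and terms whose two exponents lie strictly between `v_i` and `v_{i+1}`; so steps and jumps
take leading terms to leading terms. For the raising operator, which is not a product of triangular
operators, exponents are compared after each factor `𝐓_i⁻¹` through what the remaining factors make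
of them when they carry the same entry to the end (`affineAt`); with this comparison each factor is
triangular (`affineAt_beadLT`).

The coefficient of the leading monomial is followed in `V_μ`. The permutation in a vertex is the
rank permutation of `v`. A step multiplies `R_v` by `T_i`, a jump moves `T_i` past `R_v` and so
replaces `𝕋` by the exchanged tableau, and the raising operator multiplies, up to scalars, by
`T_i^{±1}` in the pattern that produces the Hecke element of the new rank permutation. All this uses
that `R_v` does not depend on the choice of a reduced word. This is Matsumoto's theorem
(`foldr_eq_foldr_of_wordPerm_eq`) and the braid relations on `V_μ`, which are checked in the larger
space of all fillings, where a single formula describes the generators (`fillingT_braid`).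

Paths exist because moves can be undone: from exponent `0` a tableau that is not the root has an
inverse jump (`exists_path_zero`), and a nonzero exponent has an inverse step or an inverse affine
move (`exists_path`).
-/

noncomputable section

namespace VVMacdonald

open MvPolynomial
open scoped TensorProduct

/-! ### Entries of a reverse standard tableau -/

namespace RST

variable {μ : YoungDiagram} {n : ℕ} (T : RST μ n)

theorem eq_of_row_col {k l : Fin (n + 1)} (hr : T.row k = T.row l) (hc : T.col k = T.col l) :
    k = l :=
  T.1.symm.injective (Subtype.ext (Prod.ext hr hc))

theorem exists_entry {r c : ℕ} (l : Fin (n + 1)) (hr : r ≤ T.row l) (hc : c ≤ T.col l) :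
    ∃ k, T.row k = r ∧ T.col k = c := by
  have hmem : (r, c) ∈ μ.cells :=
    μ.isLowerSet (show ((r, c) : ℕ × ℕ) ≤ (T.1.symm l).1 from ⟨hr, hc⟩) (T.1.symm l).2
  refine ⟨T.1 ⟨(r, c), hmem⟩, ?_, ?_⟩ <;> simp [row, col]

theorem lt_of_row_eq {k l : Fin (n + 1)} (hr : T.row k = T.row l) (hc : T.col k < T.col l) :
    l < k := by
  simpa using T.2.1 (T.1.symm k) (T.1.symm l) hr hc

theorem lt_of_col_eq {k l : Fin (n + 1)} (hc : T.col k = T.col l) (hr : T.row k < T.row l) :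
    l < k := by
  simpa using T.2.2 (T.1.symm k) (T.1.symm l) hc hr

theorem le_of_row_le_of_col_le {k l : Fin (n + 1)} (hr : T.row k ≤ T.row l)
    (hc : T.col k ≤ T.col l) : l ≤ k := by
  obtain ⟨m, hm1, hm2⟩ := T.exists_entry l hr le_rfl
  have h1 : m ≤ k := by
    rcases hc.lt_or_eq with h | h
    · exact (T.lt_of_row_eq hm1.symm (by omega)).le
    · exact (T.eq_of_row_col hm1 (by omega)).le
  have h2 : l ≤ m := by
    rcases hr.lt_or_eq with h | h
    · exact (T.lt_of_col_eq hm2 (by omega)).le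
    · exact (T.eq_of_row_col (by omega) hm2.symm).le
  exact h2.trans h1

/-- Consecutive entries in one row lie in adjacent cells, the larger one to the left. -/
theorem content_of_row_eq {i : Fin n} (hr : T.row i.castSucc = T.row i.succ) :
    T.content i.succ - T.content i.castSucc = -1 := by
  have h1 : T.col i.succ < T.col i.castSucc := by
    by_contra! h
    exact absurd (T.le_of_row_le_of_col_le hr.le h) (not_le.mpr i.castSucc_lt_succ)
  have h2 : T.col i.castSucc = T.col i.succ + 1 := by
    by_contra hne
    obtain ⟨m, hm1, hm2⟩ := T.exists_entry i.castSucc (c := T.col i.succ + 1) le_rfl (by omega)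
    have h3 := T.lt_of_row_eq (k := i.succ) (l := m) (by omega) (by omega)
    have h4 := T.lt_of_row_eq (k := m) (l := i.castSucc) hm1 (by omega)
    simp only [Fin.lt_def, Fin.val_castSucc, Fin.val_succ] at h3 h4
    omega
  simp only [content]
  omega

/-- Consecutive entries in one column lie in adjacent cells, the larger one on top. -/
theorem content_of_col_eq {i : Fin n} (hc : T.col i.castSucc = T.col i.succ) :
    T.content i.succ - T.content i.castSucc = 1 ∧ T.row i.succ < T.row i.castSucc := by
  have h1 : T.row i.succ < T.row i.castSucc := by
    by_contra! h
    exact absurd (T.le_of_row_le_of_col_le h hc.le) (not_le.mpr i.castSucc_lt_succ)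
  have h2 : T.row i.castSucc = T.row i.succ + 1 := by
    by_contra hne
    obtain ⟨m, hm1, hm2⟩ := T.exists_entry i.castSucc (r := T.row i.succ + 1) (by omega) le_rfl
    have h3 := T.lt_of_col_eq (k := i.succ) (l := m) (by omega) (by omega)
    have h4 := T.lt_of_col_eq (k := m) (l := i.castSucc) hm2 (by omega)
    simp only [Fin.lt_def, Fin.val_castSucc, Fin.val_succ] at h3 h4
    omega
  simp only [content]
  omega

/-- Two cells on a diagonal enclose at least two further cells, whose entries lie strictly between
theirs. Hence the contents of three consecutive entries are distinct. -/
theorem add_three_le_of_content_eq {k l : Fin (n + 1)} (hkl : k < l)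
    (hc : T.content k = T.content l) : (k : ℕ) + 3 ≤ l := by
  simp only [content] at hc
  have h1 : T.row l < T.row k := by
    by_contra! h
    exact absurd (T.le_of_row_le_of_col_le h (by omega)) (not_le.mpr hkl)
  obtain ⟨m, hm1, hm2⟩ := T.exists_entry k (r := T.row l) (c := T.col l + 1) (by omega) (by omega)
  obtain ⟨m', hm1', hm2'⟩ :=
    T.exists_entry k (r := T.row l + 1) (c := T.col l) (by omega) (by omega)
  have hne : m ≠ m' := by rintro rfl; omega
  have hne1 : m ≠ k := by rintro rfl; omega
  have hne2 : m ≠ l := by rintro rfl; omega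
  have hne3 : m' ≠ k := by rintro rfl; omega
  have hne4 : m' ≠ l := by rintro rfl; omega
  have h3 := T.le_of_row_le_of_col_le (k := l) (l := m) (by omega) (by omega)
  have h4 := T.le_of_row_le_of_col_le (k := m) (l := k) (by omega) (by omega)
  have h5 := T.le_of_row_le_of_col_le (k := l) (l := m') (by omega) (by omega)
  have h6 := T.le_of_row_le_of_col_le (k := m') (l := k) (by omega) (by omega)
  simp only [ne_eq, Fin.ext_iff, Fin.le_def] at *
  omega

theorem content_ne {k l : Fin (n + 1)} (hkl : k ≠ l) (h1 : (k : ℕ) < l + 3)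
    (h2 : (l : ℕ) < k + 3) : T.content k ≠ T.content l := by
  intro h
  rcases lt_or_gt_of_ne hkl with h' | h'
  · have := T.add_three_le_of_content_eq h' h
    omega
  · have := T.add_three_le_of_content_eq h' h.symm
    omega

end RST

/-! ### The Hecke relations on `V_μ` -/

section Hecke

variable {K : Type*} [Field K] {μ : YoungDiagram} {n : ℕ}

/-- Content of a cell. -/
def cellContent (c : {c // c ∈ μ.cells}) : ℤ := (c.1.2 : ℤ) - (c.1.1 : ℤ)

/-- The diagonal coefficient of a Hecke generator that exchanges the entries of `c` and `d`, where
`c` contains the smaller entry. -/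
def diagCoeff (s : K) (c d : {c // c ∈ μ.cells}) : K :=
  (s - 1) / (1 - s ^ (cellContent d - cellContent c))

/-- The off-diagonal coefficient of a Hecke generator that exchanges the entries of `c` and `d`,
where `c` contains the smaller entry. Cells are compared lexicographically, so that for any two
distinct cells exactly one order of the two entries has coefficient `1`. -/
def offCoeff (s : K) (c d : {c // c ∈ μ.cells}) : K :=
  if toLex c.1 < toLex d.1 then 1 else
    s * (1 - s ^ (cellContent d - cellContent c + 1))
      * (1 - s ^ (cellContent d - cellContent c - 1))
      / (1 - s ^ (cellContent d - cellContent c)) ^ 2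

/-- The space with basis all fillings of `μ`, standard or not. It contains `V_μ`, and on it the
seminormal form of a generator is given by one formula. -/
abbrev FillingSpace (K : Type*) [Field K] (μ : YoungDiagram) (n : ℕ) : Type _ :=
  ({c // c ∈ μ.cells} ≃ Fin (n + 1)) →₀ K

/-- The operator on the space of fillings that extends a Hecke generator; it exchanges the entries
`p` and `q`. -/
def fillingT (s : K) (p q : Fin (n + 1)) : FillingSpace K μ n →ₗ[K] FillingSpace K μ n :=
  Finsupp.linearCombination K fun f =>
    diagCoeff s (f.symm p) (f.symm q) • Finsupp.single f 1
      + offCoeff s (f.symm p) (f.symm q) • Finsupp.single (f.trans (Equiv.swap p q)) 1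

theorem fillingT_single (s : K) (p q : Fin (n + 1)) (f : {c // c ∈ μ.cells} ≃ Fin (n + 1)) :
    fillingT s p q (Finsupp.single f 1) =
    diagCoeff s (f.symm p) (f.symm q) • Finsupp.single f 1
      + offCoeff s (f.symm p) (f.symm q) • Finsupp.single (f.trans (Equiv.swap p q)) 1 := by
  simp [fillingT]

theorem diagCoeff_add {s : K} {c d : {c // c ∈ μ.cells}} (hs0 : s ≠ 0)
    (h : s ^ cellContent c ≠ s ^ cellContent d) :
    diagCoeff s c d + diagCoeff s d c = s - 1 := by
  simp only [diagCoeff, zpow_sub₀ hs0]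
  have hc := zpow_ne_zero (cellContent c) hs0
  have hd := zpow_ne_zero (cellContent d) hs0
  generalize s ^ cellContent c = x at *
  generalize s ^ cellContent d = y at *
  have h1 : x - y ≠ 0 := sub_ne_zero.mpr h
  have h2 : y - x ≠ 0 := sub_ne_zero.mpr h.symm
  have h3 : 1 - y / x = (x - y) / x := by field_simp
  have h4 : 1 - x / y = (y - x) / y := by field_simp
  rw [h3, h4]
  field_simp
  ring

/-- The relation between the two coefficients that gives the quadratic relation. -/
theorem offCoeff_mul {s : K} {c d : {c // c ∈ μ.cells}} (hs0 : s ≠ 0)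
    (h : s ^ cellContent c ≠ s ^ cellContent d) :
    offCoeff s c d * offCoeff s d c = (s - diagCoeff s c d) * (1 + diagCoeff s c d) := by
  have hc := zpow_ne_zero (cellContent c) hs0
  have hd := zpow_ne_zero (cellContent d) hs0
  have hr : toLex c.1 ≠ toLex d.1 := fun hcd => h (by rw [Subtype.ext (toLex.injective hcd)])
  rcases lt_or_gt_of_ne hr with hr | hr
  · simp only [offCoeff, if_pos hr, if_neg hr.not_gt, diagCoeff, zpow_add₀ hs0, zpow_sub₀ hs0,
      zpow_one]
    generalize s ^ cellContent c = x at *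
    generalize s ^ cellContent d = y at *
    have h1 : x - y ≠ 0 := sub_ne_zero.mpr h
    have h2 : y - x ≠ 0 := sub_ne_zero.mpr h.symm
    have h3 : 1 - y / x = (x - y) / x := by field_simp
    have h4 : 1 - x / y = (y - x) / y := by field_simp
    rw [h3, h4]
    field_simp
    ring
  · simp only [offCoeff, if_pos hr, if_neg hr.not_gt, diagCoeff, zpow_add₀ hs0, zpow_sub₀ hs0,
      zpow_one]
    generalize s ^ cellContent c = x at *
    generalize s ^ cellContent d = y at *
    have h1 : x - y ≠ 0 := sub_ne_zero.mpr h
    have h3 : 1 - y / x = (x - y) / x := by field_simp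
    rw [h3]
    field_simp
    ring

theorem diagCoeff_mul {s : K} {a b c : {c // c ∈ μ.cells}} (hs0 : s ≠ 0)
    (hab : s ^ cellContent a ≠ s ^ cellContent b) (hac : s ^ cellContent a ≠ s ^ cellContent c)
    (hbc : s ^ cellContent b ≠ s ^ cellContent c) :
    diagCoeff s a b * diagCoeff s b c + diagCoeff s a c * diagCoeff s b a
      = diagCoeff s b c * diagCoeff s a c := by
  have ha := zpow_ne_zero (cellContent a) hs0
  have hb := zpow_ne_zero (cellContent b) hs0
  have hc := zpow_ne_zero (cellContent c) hs0
  simp only [diagCoeff, zpow_sub₀ hs0]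
  generalize s ^ cellContent a = x at *
  generalize s ^ cellContent b = y at *
  generalize s ^ cellContent c = z at *
  have h1 : x - y ≠ 0 := sub_ne_zero.mpr hab
  have h1' : y - x ≠ 0 := sub_ne_zero.mpr hab.symm
  have h2 : x - z ≠ 0 := sub_ne_zero.mpr hac
  have h3 : y - z ≠ 0 := sub_ne_zero.mpr hbc
  have e1 : 1 - y / x = (x - y) / x := by field_simp
  have e2 : 1 - x / y = (y - x) / y := by field_simp
  have e3 : 1 - z / x = (x - z) / x := by field_simp
  have e4 : 1 - z / y = (y - z) / y := by field_simp
  rw [e1, e2, e3, e4]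
  field_simp
  ring

/-- The quadratic relation also holds on nonstandard fillings, as long as the two entries have
different contents. -/
theorem fillingT_fillingT {s : K} (hs0 : s ≠ 0) {p q : Fin (n + 1)}
    {f : {c // c ∈ μ.cells} ≃ Fin (n + 1)}
    (h : s ^ cellContent (f.symm p) ≠ s ^ cellContent (f.symm q)) :
    fillingT s p q (fillingT s p q (Finsupp.single f 1)) =
      (s - 1) • fillingT s p q (Finsupp.single f 1) + s • Finsupp.single f (1 : K) := by
  have hff : (f.trans (Equiv.swap p q)).trans (Equiv.swap p q) = f := by ext; simp
  have h1 := fillingT_single s p q (f.trans (Equiv.swap p q))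
  simp only [hff, Equiv.symm_trans_apply, Equiv.symm_swap, Equiv.swap_apply_left,
    Equiv.swap_apply_right] at h1
  simp only [fillingT_single s p q f, map_add, map_smul, h1]
  have e1 := diagCoeff_add hs0 h
  have e2 := offCoeff_mul hs0 h
  generalize f.symm p = a at *
  generalize f.symm q = b at *
  linear_combination (norm := module)
    (offCoeff s a b * e1) • Finsupp.single (f.trans (Equiv.swap p q)) (1 : K)
    + e2 • Finsupp.single f (1 : K)

/-- The braid relation also holds on nonstandard fillings, as long as the three entries have
different contents. -/
theorem fillingT_braid {s : K} (hs0 : s ≠ 0) {p q r : Fin (n + 1)} (hpq : p ≠ q) (hpr : p ≠ r)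
    (hqr : q ≠ r) {f : {c // c ∈ μ.cells} ≃ Fin (n + 1)}
    (hab : s ^ cellContent (f.symm p) ≠ s ^ cellContent (f.symm q))
    (hac : s ^ cellContent (f.symm p) ≠ s ^ cellContent (f.symm r))
    (hbc : s ^ cellContent (f.symm q) ≠ s ^ cellContent (f.symm r)) :
    fillingT s p q (fillingT s q r (fillingT s p q (Finsupp.single f 1))) =
      fillingT s q r (fillingT s p q (fillingT s q r (Finsupp.single f 1))) := by
  set x := Equiv.swap p q with hx
  set y := Equiv.swap q r with hy
  have xp : x p = q := by simp [hx]
  have xq : x q = p := by simp [hx]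
  have xr : x r = r := Equiv.swap_apply_of_ne_of_ne hpr.symm hqr.symm
  have yp : y p = p := Equiv.swap_apply_of_ne_of_ne hpq hpr
  have yq : y q = r := by simp [hy]
  have yr : y r = q := by simp [hy]
  have xs : x.symm = x := by simp [hx]
  have ys : y.symm = y := by simp [hy]
  have hxx : (f.trans x).trans x = f := by ext; simp [hx]
  have hyy : (f.trans y).trans y = f := by ext; simp [hy]
  have hxyx : ((f.trans x).trans y).trans x = ((f.trans y).trans x).trans y := by
    ext c
    simp only [Equiv.trans_apply]
    generalize f c = k
    by_cases h1 : k = p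
    · rw [h1, xp, yq, xr, yp, xp, yq]
    by_cases h2 : k = q
    · rw [h2, xq, yp, xp, yq, xr, yr]
    by_cases h3 : k = r
    · rw [h3, xr, yr, xq, yp]
    · rw [hx, hy, Equiv.swap_apply_of_ne_of_ne h1 h2, Equiv.swap_apply_of_ne_of_ne h2 h3,
        Equiv.swap_apply_of_ne_of_ne h1 h2, Equiv.swap_apply_of_ne_of_ne h2 h3]
  have k1 := fillingT_single s p q (f.trans x)
  have k2 := fillingT_single s q r (f.trans y)
  have k3 := fillingT_single s q r (f.trans x)
  have k4 := fillingT_single s p q (f.trans y)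
  have k5 := fillingT_single s p q ((f.trans x).trans y)
  have k6 := fillingT_single s q r ((f.trans y).trans x)
  simp only [← hx, ← hy, hxx, hyy, hxyx, Equiv.symm_trans_apply, xs, ys, xp, xq, xr, yp, yq, yr]
    at k1 k2 k3 k4 k5 k6
  simp only [fillingT_single s p q f, fillingT_single s q r f, map_add, map_smul, ← hx, ← hy,
    k1, k2, k3, k4, k5, k6]
  have e1 := offCoeff_mul hs0 hab
  have e2 := offCoeff_mul hs0 hbc
  have e3 := diagCoeff_mul hs0 hab hac hbc
  have e4 := diagCoeff_add hs0 hab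
  have e5 := diagCoeff_add hs0 hbc
  generalize f.symm p = a at *
  generalize f.symm q = b at *
  generalize f.symm r = c at *
  generalize diagCoeff s a b = dab at *
  generalize diagCoeff s b c = dbc at *
  generalize diagCoeff s a c = dac at *
  generalize diagCoeff s b a = dba at *
  generalize diagCoeff s c b = dcb at *
  obtain rfl : dba = s - 1 - dab := by linear_combination e4
  obtain rfl : dcb = s - 1 - dbc := by linear_combination e5
  -- The coefficients of three of the six fillings agree trivially; the other three are compared.
  linear_combination (norm := module)
    (offCoeff s a b * e3) • Finsupp.single (f.trans x) (1 : K)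
    - (offCoeff s b c * e3) • Finsupp.single (f.trans y) (1 : K)
    + (dac * e1 - dac * e2 + (dab - dbc) * e3) • Finsupp.single f (1 : K)

theorem fillingT_comm {s : K} {p q p' q' : Fin (n + 1)} (h1 : p ≠ p') (h2 : p ≠ q') (h3 : q ≠ p')
    (h4 : q ≠ q') (f : {c // c ∈ μ.cells} ≃ Fin (n + 1)) :
    fillingT s p q (fillingT s p' q' (Finsupp.single f (1 : K))) =
      fillingT s p' q' (fillingT s p q (Finsupp.single f 1)) := by
  set x := Equiv.swap p q with hx
  set y := Equiv.swap p' q' with hy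
  have xp : x p' = p' := Equiv.swap_apply_of_ne_of_ne h1.symm h3.symm
  have xq : x q' = q' := Equiv.swap_apply_of_ne_of_ne h2.symm h4.symm
  have yp : y p = p := Equiv.swap_apply_of_ne_of_ne h1 h2
  have yq : y q = q := Equiv.swap_apply_of_ne_of_ne h3 h4
  have xs : x.symm = x := by simp [hx]
  have ys : y.symm = y := by simp [hy]
  have hxy : (f.trans y).trans x = (f.trans x).trans y := by
    ext c
    simp only [Equiv.trans_apply]
    generalize f c = k
    by_cases k1 : k = p
    · rw [k1, yp, hx, Equiv.swap_apply_left, yq]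
    by_cases k2 : k = q
    · rw [k2, yq, hx, Equiv.swap_apply_right, yp]
    rw [show x k = k from Equiv.swap_apply_of_ne_of_ne k1 k2]
    by_cases k3 : k = p'
    · rw [k3, hy, Equiv.swap_apply_left, xq]
    by_cases k4 : k = q'
    · rw [k4, hy, Equiv.swap_apply_right, xp]
    rw [show y k = k from Equiv.swap_apply_of_ne_of_ne k3 k4,
      show x k = k from Equiv.swap_apply_of_ne_of_ne k1 k2]
  have k1 := fillingT_single s p' q' (f.trans x)
  have k2 := fillingT_single s p q (f.trans y)
  simp only [← hx, ← hy, hxy, Equiv.symm_trans_apply, xs, ys, xp, xq, yp, yq] at k1 k2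
  simp only [fillingT_single s p q f, fillingT_single s p' q' f, map_add, map_smul, ← hx, ← hy,
    k1, k2]
  module

/-- The embedding of `V_μ` into the space of fillings. -/
def toFillings (K : Type*) [Field K] (μ : YoungDiagram) (n : ℕ) :
    V K μ n →ₗ[K] FillingSpace K μ n :=
  Finsupp.lmapDomain K K Subtype.val

theorem toFillings_injective : Function.Injective (toFillings K μ n) :=
  Finsupp.mapDomain_injective Subtype.val_injective

theorem toFillings_single (T : RST μ n) (a : K) :
    toFillings K μ n (Finsupp.single T a) = Finsupp.single T.1 a :=
  Finsupp.mapDomain_single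

theorem zpow_injective_of_pow_ne_one {s : K} (hs0 : s ≠ 0) (hs : ∀ k : ℕ, 0 < k → s ^ k ≠ 1) :
    Function.Injective fun m : ℤ => s ^ m := by
  have key : ∀ k l : ℤ, k < l → s ^ k ≠ s ^ l := by
    intro k l hkl h
    obtain ⟨d, hd⟩ := Int.eq_ofNat_of_zero_le (sub_nonneg.mpr hkl.le)
    refine hs d (by omega) ?_
    rw [← zpow_natCast, ← hd, zpow_sub₀ hs0, h, div_self (zpow_ne_zero _ hs0)]
  intro k l h
  rcases lt_trichotomy k l with h' | h' | h'
  · exact absurd h (key k l h')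
  · exact h'
  · exact absurd h.symm (key l k h')

/-- On tableaux, the uniform formula specializes to the action of the Hecke generator: in a single
row or column the off-diagonal coefficient vanishes, because the entries are adjacent. -/
theorem toFillings_tableauT {s : K} (hs0 : s ≠ 0) (hs : ∀ k : ℕ, 0 < k → s ^ k ≠ 1) (i : Fin n)
    (T : RST μ n) :
    toFillings K μ n (tableauT s i T) = fillingT s i.castSucc i.succ (Finsupp.single T.1 1) := by
  have hs1 : s - 1 ≠ 0 := sub_ne_zero.mpr (by simpa using hs 1 one_pos)
  have hc : ∀ k, cellContent (T.1.symm k) = T.content k := fun _ => rfl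
  have hr : ∀ k, (T.1.symm k).1.1 = T.row k := fun _ => rfl
  have hcol : ∀ k, (T.1.symm k).1.2 = T.col k := fun _ => rfl
  rw [fillingT_single]
  unfold tableauT
  split_ifs with h1 h2 h3
  · have hm := T.content_of_row_eq h1
    have hcl : T.col i.succ < T.col i.castSucc := by
      simp only [RST.content] at hm; omega
    have hd : diagCoeff s (T.1.symm i.castSucc) (T.1.symm i.succ) = s := by
      rw [diagCoeff, hc, hc, hm, zpow_neg_one]
      have : 1 - s⁻¹ = (s - 1) / s := by field_simp
      rw [this]
      field_simp
    have ho : offCoeff s (T.1.symm i.castSucc) (T.1.symm i.succ) = 0 := by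
      rw [offCoeff, if_neg, hc, hc, hm]
      · simp
      · rw [Prod.Lex.toLex_lt_toLex, hr, hr, hcol, hcol]; omega
    rw [hd, ho, map_smul, toFillings_single, zero_smul, add_zero]
  · obtain ⟨hm, hcl⟩ := T.content_of_col_eq h2
    have hd : diagCoeff s (T.1.symm i.castSucc) (T.1.symm i.succ) = -1 := by
      rw [diagCoeff, hc, hc, hm, zpow_one,
        div_eq_iff (by rw [← neg_sub]; exact neg_ne_zero.mpr hs1)]
      ring
    have ho : offCoeff s (T.1.symm i.castSucc) (T.1.symm i.succ) = 0 := by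
      rw [offCoeff, if_neg, hc, hc, hm]
      · simp
      · rw [Prod.Lex.toLex_lt_toLex, hr, hr, hcol, hcol]; omega
    rw [hd, ho, map_neg, toFillings_single, zero_smul, add_zero, neg_one_smul]
  · have ht := toFillings_single (K := K)
      (⟨T.swapFilling i.castSucc i.succ, T.isRST_swapFilling i h1 h2⟩ : RST μ n) 1
    have ho : offCoeff s (T.1.symm i.castSucc) (T.1.symm i.succ) = 1 := by
      rw [offCoeff, if_pos]
      rw [Prod.Lex.toLex_lt_toLex, hr, hr]; omega
    rw [map_sub, map_smul, ht, toFillings_single, ho, diagCoeff, hc, hc, ← neg_sub 1 s,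
      neg_div]
    unfold RST.swapFilling
    module
  · have ht := toFillings_single (K := K)
      (⟨T.swapFilling i.castSucc i.succ, T.isRST_swapFilling i h1 h2⟩ : RST μ n) 1
    have ho : offCoeff s (T.1.symm i.castSucc) (T.1.symm i.succ) =
        s * (1 - s ^ (T.content i.succ - T.content i.castSucc + 1))
          * (1 - s ^ (T.content i.succ - T.content i.castSucc - 1))
          / (1 - s ^ (T.content i.succ - T.content i.castSucc)) ^ 2 := by
      rw [offCoeff, if_neg, hc, hc]
      rw [Prod.Lex.toLex_lt_toLex, hr, hr]; omega
    rw [map_add, map_smul, map_smul, ht, toFillings_single, ho, diagCoeff, hc, hc]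
    rfl

theorem toFillings_heckeT {s : K} (hs0 : s ≠ 0) (hs : ∀ k : ℕ, 0 < k → s ^ k ≠ 1) (i : Fin n)
    (u : V K μ n) :
    toFillings K μ n (heckeT μ s i u) = fillingT s i.castSucc i.succ (toFillings K μ n u) := by
  induction u using Finsupp.induction_linear with
  | zero => simp
  | add u w hu hw => simp only [map_add, hu, hw]
  | single T a =>
    have : (Finsupp.single T a : V K μ n) = a • Finsupp.single T 1 := by simp
    rw [this, map_smul, map_smul, map_smul, map_smul, toFillings_single,
      ← toFillings_tableauT hs0 hs]
    simp [heckeT]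

theorem ext_tableau {A B : V K μ n →ₗ[K] FillingSpace K μ n}
    (h : ∀ T : RST μ n, A (Finsupp.single T 1) = B (Finsupp.single T 1)) (u : V K μ n) :
    A u = B u := by
  have : A = B := Finsupp.lhom_ext' fun T => LinearMap.ext_ring (h T)
  rw [this]

theorem heckeT_heckeT {s : K} (hs0 : s ≠ 0) (hs : ∀ k : ℕ, 0 < k → s ^ k ≠ 1) (i : Fin n)
    (u : V K μ n) :
    heckeT μ s i (heckeT μ s i u) = (s - 1) • heckeT μ s i u + s • u := by
  apply toFillings_injective
  simp only [map_add, map_smul, toFillings_heckeT hs0 hs]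
  refine ext_tableau (A := fillingT s i.castSucc i.succ ∘ₗ fillingT s i.castSucc i.succ ∘ₗ
    toFillings K μ n) (B := (s - 1) • (fillingT s i.castSucc i.succ ∘ₗ toFillings K μ n)
      + s • toFillings K μ n) (fun T => ?_) u
  simp only [LinearMap.comp_apply, LinearMap.add_apply, LinearMap.smul_apply, toFillings_single]
  refine fillingT_fillingT hs0 fun h => T.content_ne i.castSucc_lt_succ.ne ?_ ?_
    (zpow_injective_of_pow_ne_one hs0 hs h)
  · simp
    omega
  · simp

theorem heckeT_braid {s : K} (hs0 : s ≠ 0) (hs : ∀ k : ℕ, 0 < k → s ^ k ≠ 1) {i j : Fin n}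
    (hij : (j : ℕ) = i + 1) (u : V K μ n) :
    heckeT μ s i (heckeT μ s j (heckeT μ s i u)) =
      heckeT μ s j (heckeT μ s i (heckeT μ s j u)) := by
  apply toFillings_injective
  have hq : j.castSucc = i.succ := by ext; simp [hij]
  simp only [toFillings_heckeT hs0 hs, hq]
  refine ext_tableau (A := fillingT s i.castSucc i.succ ∘ₗ fillingT s i.succ j.succ ∘ₗ
    fillingT s i.castSucc i.succ ∘ₗ toFillings K μ n)
    (B := fillingT s i.succ j.succ ∘ₗ fillingT s i.castSucc i.succ ∘ₗ
    fillingT s i.succ j.succ ∘ₗ toFillings K μ n) (fun T => ?_) u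
  simp only [LinearMap.comp_apply, toFillings_single]
  have h1 : i.castSucc ≠ i.succ := i.castSucc_lt_succ.ne
  have h2 : i.castSucc ≠ j.succ := by simp [Fin.ext_iff]; omega
  have h3 : i.succ ≠ j.succ := by simp [Fin.ext_iff]; omega
  refine fillingT_braid hs0 h1 h2 h3 (fun h => T.content_ne h1 ?_ ?_
      (zpow_injective_of_pow_ne_one hs0 hs h)) (fun h => T.content_ne h2 ?_ ?_
      (zpow_injective_of_pow_ne_one hs0 hs h)) (fun h => T.content_ne h3 ?_ ?_
      (zpow_injective_of_pow_ne_one hs0 hs h)) <;> simp <;> omega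

theorem heckeT_comm {s : K} (hs0 : s ≠ 0) (hs : ∀ k : ℕ, 0 < k → s ^ k ≠ 1) {i j : Fin n}
    (hij : (i : ℕ) + 1 < j) (u : V K μ n) :
    heckeT μ s i (heckeT μ s j u) = heckeT μ s j (heckeT μ s i u) := by
  apply toFillings_injective
  simp only [toFillings_heckeT hs0 hs]
  refine ext_tableau (A := fillingT s i.castSucc i.succ ∘ₗ fillingT s j.castSucc j.succ ∘ₗ
    toFillings K μ n) (B := fillingT s j.castSucc j.succ ∘ₗ fillingT s i.castSucc i.succ ∘ₗ
    toFillings K μ n) (fun T => ?_) u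
  simp only [LinearMap.comp_apply, toFillings_single]
  apply fillingT_comm <;> simp [Fin.ext_iff] <;> omega

/-! ### Inverse generators -/

theorem heckeTInv_apply (s : K) (i : Fin n) (u : V K μ n) :
    heckeTInv μ s i u = s⁻¹ • (heckeT μ s i u + (1 - s) • u) := rfl

theorem heckeT_heckeTInv {s : K} (hs0 : s ≠ 0) (hs : ∀ k : ℕ, 0 < k → s ^ k ≠ 1) (i : Fin n)
    (u : V K μ n) : heckeT μ s i (heckeTInv μ s i u) = u := by
  rw [heckeTInv_apply, map_smul, map_add, map_smul, heckeT_heckeT hs0 hs, inv_smul_eq_iff₀ hs0]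
  module

theorem heckeTInv_heckeT {s : K} (hs0 : s ≠ 0) (hs : ∀ k : ℕ, 0 < k → s ^ k ≠ 1) (i : Fin n)
    (u : V K μ n) : heckeTInv μ s i (heckeT μ s i u) = u := by
  rw [heckeTInv_apply, heckeT_heckeT hs0 hs, inv_smul_eq_iff₀ hs0]
  module

theorem heckeTInv_braid {s : K} (hs0 : s ≠ 0) (hs : ∀ k : ℕ, 0 < k → s ^ k ≠ 1) {i j : Fin n}
    (hij : (j : ℕ) = i + 1) (u : V K μ n) :
    heckeTInv μ s i (heckeTInv μ s j (heckeTInv μ s i u)) =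
      heckeTInv μ s j (heckeTInv μ s i (heckeTInv μ s j u)) := by
  have hinj : ∀ k : Fin n, Function.Injective (heckeT μ s k) := fun k =>
    Function.LeftInverse.injective (heckeTInv_heckeT hs0 hs k)
  apply hinj i
  apply hinj j
  apply hinj i
  rw [heckeT_braid hs0 hs hij (heckeTInv μ s j _)]
  simp only [heckeT_heckeTInv hs0 hs]

theorem heckeTInv_comm {s : K} (hs0 : s ≠ 0) (hs : ∀ k : ℕ, 0 < k → s ^ k ≠ 1) {i j : Fin n}
    (hij : (i : ℕ) + 1 < j) (u : V K μ n) :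
    heckeTInv μ s i (heckeTInv μ s j u) = heckeTInv μ s j (heckeTInv μ s i u) := by
  have hinj : ∀ k : Fin n, Function.Injective (heckeT μ s k) := fun k =>
    Function.LeftInverse.injective (heckeTInv_heckeT hs0 hs k)
  apply hinj i
  apply hinj j
  rw [← heckeT_comm hs0 hs hij (heckeTInv μ s j _)]
  simp only [heckeT_heckeTInv hs0 hs]

end Hecke

/-! ### Inversions and reduced words of permutations -/

section Words

variable {n : ℕ}

theorem simple_simple (i : Fin n) (a : Fin (n + 1)) : simple i (simple i a) = a :=
  Equiv.swap_apply_self _ _ _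

theorem simple_mul_self (i : Fin n) : simple i * simple i = 1 := Equiv.swap_mul_self _ _

theorem simple_castSucc (i : Fin n) : simple i i.castSucc = i.succ := Equiv.swap_apply_left _ _

theorem simple_succ (i : Fin n) : simple i i.succ = i.castSucc := Equiv.swap_apply_right _ _

theorem simple_of_ne {i : Fin n} {a : Fin (n + 1)} (h1 : a ≠ i.castSucc) (h2 : a ≠ i.succ) :
    simple i a = a := Equiv.swap_apply_of_ne_of_ne h1 h2

theorem wordPerm_cons (i : Fin n) (w : List (Fin n)) :
    wordPerm (i :: w) = wordPerm w * simple i := by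
  simp [wordPerm]

theorem wordPerm_append_singleton (w : List (Fin n)) (i : Fin n) :
    wordPerm (w ++ [i]) = simple i * wordPerm w := by
  simp [wordPerm]

/-- Two permutations with the same order pattern are equal. -/
theorem perm_eq_of_lt_iff {σ τ : Equiv.Perm (Fin (n + 1))} (h : ∀ a b, σ a < σ b ↔ τ a < τ b) :
    σ = τ := by
  have h1 : StrictMono (σ ∘ τ.symm) := fun a b hab => by
    simpa [h] using hab
  ext a
  simpa using congrArg Fin.val (congrFun h1.eq_id (τ a))

/-- The number of inversions. -/
def inversions (σ : Equiv.Perm (Fin (n + 1))) : ℕ :=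
  (Finset.univ.filter fun p : Fin (n + 1) × Fin (n + 1) => p.1 < p.2 ∧ σ p.2 < σ p.1).card

theorem inversions_mul_simple {σ : Equiv.Perm (Fin (n + 1))} {i : Fin n}
    (h : σ i.castSucc < σ i.succ) : inversions (σ * simple i) = inversions σ + 1 := by
  let e := Equiv.prodCongr (simple i) (simple i)
  have key : (Finset.univ.filter fun p : Fin (n + 1) × Fin (n + 1) =>
      p.1 < p.2 ∧ (σ * simple i) p.2 < (σ * simple i) p.1) =
      insert (i.castSucc, i.succ)
        ((Finset.univ.filter fun p : Fin (n + 1) × Fin (n + 1) =>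
          p.1 < p.2 ∧ σ p.2 < σ p.1).map e.toEmbedding) := by
    ext ⟨a, b⟩
    have hmem : (a, b) ∈ ((Finset.univ.filter fun p : Fin (n + 1) × Fin (n + 1) =>
        p.1 < p.2 ∧ σ p.2 < σ p.1).map e.toEmbedding) ↔
        simple i a < simple i b ∧ σ (simple i b) < σ (simple i a) := by
      rw [Finset.mem_map_equiv]
      simp [e, simple]
    rw [Finset.mem_insert, hmem]
    rw [Finset.mem_filter, Prod.mk.injEq, Equiv.Perm.mul_apply, Equiv.Perm.mul_apply]
    constructor
    · rintro ⟨-, h1, h2⟩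
      by_cases h3 : a = i.castSucc ∧ b = i.succ
      · exact Or.inl h3
      · exact Or.inr ⟨RST.simple_lt h1 h3, h2⟩
    · rintro (⟨rfl, rfl⟩ | ⟨h1, h2⟩)
      · rw [simple_castSucc, simple_succ]
        exact ⟨Finset.mem_univ _, i.castSucc_lt_succ, h⟩
      · refine ⟨Finset.mem_univ _, ?_, h2⟩
        have h3 := RST.simple_lt (i := i) h1 fun h3 => by
          rw [h3.1, h3.2] at h2
          exact absurd h2 h.not_gt
        rwa [simple_simple, simple_simple] at h3
  unfold inversions
  rw [key, Finset.card_insert_of_notMem, Finset.card_map]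
  rw [Finset.mem_map_equiv]
  simp [e, simple, i.castSucc_lt_succ.not_gt]

theorem inversions_mul_simple_add_one {σ : Equiv.Perm (Fin (n + 1))} {i : Fin n}
    (h : σ i.succ < σ i.castSucc) : inversions (σ * simple i) + 1 = inversions σ := by
  rw [← inversions_mul_simple, mul_assoc, simple_mul_self, mul_one]
  simpa [simple_castSucc, simple_succ] using h

theorem inversions_one : inversions (1 : Equiv.Perm (Fin (n + 1))) = 0 := by
  rw [inversions, Finset.card_eq_zero, Finset.filter_eq_empty_iff]
  rintro p _ ⟨h1, h2⟩
  exact absurd h1 h2.not_gt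

theorem inversions_wordPerm_le (w : List (Fin n)) : inversions (wordPerm w) ≤ w.length := by
  induction w with
  | nil => simp [wordPerm, inversions_one]
  | cons i w ih =>
    rw [wordPerm_cons, List.length_cons]
    have hne : wordPerm w i.castSucc ≠ wordPerm w i.succ :=
      (wordPerm w).injective.ne i.castSucc_lt_succ.ne
    rcases lt_or_gt_of_ne hne with h | h
    · rw [inversions_mul_simple h]
      omega
    · have := inversions_mul_simple_add_one h
      omega

theorem exists_word (σ : Equiv.Perm (Fin (n + 1))) :
    ∃ w, wordPerm w = σ ∧ w.length = inversions σ := by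
  induction hm : inversions σ generalizing σ with
  | zero =>
    refine ⟨[], ?_, rfl⟩
    have hmono : StrictMono σ := by
      rw [Fin.strictMono_iff_lt_succ]
      intro i
      by_contra! h
      have := inversions_mul_simple_add_one
        (lt_of_le_of_ne h (σ.injective.ne i.castSucc_lt_succ.ne'))
      omega
    exact perm_eq_of_lt_iff fun a b => by
      rw [hmono.lt_iff_lt]
      simp [wordPerm]
  | succ m ih =>
    obtain ⟨i, hi⟩ : ∃ i : Fin n, σ i.succ < σ i.castSucc := by
      by_contra! h
      have hmono : StrictMono σ := by
        rw [Fin.strictMono_iff_lt_succ]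
        exact fun i => lt_of_le_of_ne (h i) (σ.injective.ne i.castSucc_lt_succ.ne)
      have : σ = 1 := perm_eq_of_lt_iff fun a b => by
        rw [hmono.lt_iff_lt]
        simp
      rw [this, inversions_one] at hm
      omega
    have h1 := inversions_mul_simple_add_one hi
    obtain ⟨w, hw, hl⟩ := ih (σ * simple i) (by omega)
    refine ⟨i :: w, ?_, by simp [hl]⟩
    rw [wordPerm_cons, hw, mul_assoc, simple_mul_self, mul_one]

theorem IsShortest.length_eq {w : List (Fin n)} {σ : Equiv.Perm (Fin (n + 1))}
    (h : IsShortest w σ) : w.length = inversions σ := by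
  obtain ⟨w', hw', hl⟩ := exists_word σ
  have h1 := inversions_wordPerm_le w
  rw [h.1] at h1
  exact le_antisymm (hl ▸ h.2 w' hw') h1

theorem simple_braid {i j : Fin n} (hij : (j : ℕ) = i + 1) :
    simple i * simple j * simple i = simple j * simple i * simple j := by
  have hq : j.castSucc = i.succ := by ext; simp [hij]
  ext a
  simp only [simple, hq, Equiv.Perm.mul_apply, Equiv.swap_apply_def, Fin.ext_iff, Fin.val_castSucc,
    Fin.val_succ, hij]
  grind

theorem simple_comm {i j : Fin n} (hij : (i : ℕ) + 1 < j) :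
    simple i * simple j = simple j * simple i := by
  ext a
  simp only [simple, Equiv.Perm.mul_apply, Equiv.swap_apply_def, Fin.ext_iff, Fin.val_castSucc,
    Fin.val_succ]
  grind

/-- Matsumoto's theorem for the symmetric group: if operators satisfy the braid relations, then the
products along two reduced words of the same permutation agree. -/
theorem foldr_eq_foldr_of_wordPerm_eq {X : Type*} (A : Fin n → X → X)
    (hbraid : ∀ i j : Fin n, (j : ℕ) = i + 1 → ∀ x, A i (A j (A i x)) = A j (A i (A j x)))
    (hcomm : ∀ i j : Fin n, (i : ℕ) + 1 < j → ∀ x, A i (A j x) = A j (A i x))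
    {w w' : List (Fin n)} (hw : w.length = inversions (wordPerm w))
    (hw' : w'.length = inversions (wordPerm w)) (h : wordPerm w = wordPerm w') (x : X) :
    w.foldr A x = w'.foldr A x := by
  induction hm : w.length using Nat.strong_induction_on generalizing w w' with
  | _ m ih =>
  subst hm
  match w, w' with
  | [], w' =>
    have : w' = [] := List.length_eq_zero_iff.mp (hw'.trans hw.symm)
    rw [this]
  | i :: t, [] => simp at hw hw'; omega
  | i :: t, j :: t' =>
    -- The first letter of a reduced word is a descent, and its tail is reduced.
    have hdesc : ∀ (k : Fin n) (r : List (Fin n)),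
        (k :: r).length = inversions (wordPerm (k :: r)) →
        wordPerm (k :: r) k.succ < wordPerm (k :: r) k.castSucc ∧
          r.length = inversions (wordPerm r) ∧ wordPerm r = wordPerm (k :: r) * simple k := by
      intro k r hr
      have e : wordPerm r = wordPerm (k :: r) * simple k := by
        rw [wordPerm_cons, mul_assoc, simple_mul_self, mul_one]
      have hle := inversions_wordPerm_le r
      rw [List.length_cons] at hr
      have hne : wordPerm (k :: r) k.castSucc ≠ wordPerm (k :: r) k.succ :=
        (wordPerm (k :: r)).injective.ne k.castSucc_lt_succ.ne
      rcases lt_or_gt_of_ne hne with h1 | h1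
      · have := inversions_mul_simple h1
        rw [← e] at this
        omega
      · have := inversions_mul_simple_add_one h1
        rw [← e] at this
        exact ⟨h1, by omega, e⟩
    wlog hij : i ≤ j generalizing i j t t' with hwlog
    · refine (hwlog (i := j) (t := t') (j := i) (t' := t) (h := h.symm) (hw := by rw [← h, hw'])
        (hw' := by rw [← h, hw]) (fun m hm => ?_) (le_of_not_ge hij)).symm
      exact ih m (by rw [hw, ← hw']; exact hm)
    obtain ⟨di, li, ei⟩ := hdesc i t hw
    obtain ⟨dj, lj, ej⟩ := hdesc j t' (by rw [← h, hw'])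
    rw [← h] at dj ej
    set σ := wordPerm (i :: t)
    have hlen : t.length + 1 = inversions σ := hw
    have hlen' : t'.length + 1 = inversions σ := hw'
    simp only [List.foldr_cons]
    have IH : ∀ {r r' : List (Fin n)}, r.length = t.length → r.length = inversions (wordPerm r) →
        r'.length = r.length → wordPerm r = wordPerm r' → r.foldr A x = r'.foldr A x := by
      intro r r' h1 h2 h3 h4
      exact ih r.length (by simp [h1]) h2 (by omega) h4 rfl
    rcases hij.eq_or_lt with rfl | hij
    · rw [IH (r := t) (r' := t') rfl li (by omega) (by rw [ei, ej])]
    rw [Fin.lt_def] at hij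
    have hji : j.castSucc ≠ i.castSucc := by simp [Fin.ext_iff]; omega
    have hji' : j.succ ≠ i.castSucc := by simp [Fin.ext_iff]; omega
    have hjj : j.succ ≠ i.succ := by simp [Fin.ext_iff]; omega
    rcases (Nat.succ_le_of_lt hij).eq_or_lt with hadj | hfar
    · have hadj : (j : ℕ) = i + 1 := hadj.symm
      have hq : j.castSucc = i.succ := by ext; simp [hadj]
      have h1 := inversions_mul_simple_add_one di
      have h2 : inversions (σ * simple i * simple j) + 1 = inversions (σ * simple i) := by
        apply inversions_mul_simple_add_one
        rw [Equiv.Perm.mul_apply, Equiv.Perm.mul_apply, hq, simple_succ, simple_of_ne hji' hjj]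
        rw [hq] at dj
        exact dj.trans di
      have h3 : inversions (σ * simple i * simple j * simple i) + 1
          = inversions (σ * simple i * simple j) := by
        apply inversions_mul_simple_add_one
        simp only [Equiv.Perm.mul_apply]
        rw [← hq, simple_castSucc, simple_of_ne hji' hjj, simple_of_ne hji.symm hji'.symm,
          simple_castSucc, ← hq]
        exact dj
      obtain ⟨y, hy, hyl⟩ := exists_word (σ * simple i * simple j * simple i)
      have e1 : wordPerm t = wordPerm (j :: i :: y) := by
        rw [wordPerm_cons, wordPerm_cons, hy, ei]
        simp only [mul_assoc, simple_mul_self, mul_one]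
      have e2 : wordPerm t' = wordPerm (i :: j :: y) := by
        rw [wordPerm_cons, wordPerm_cons, hy, ej]
        have : σ * simple i * simple j * simple i = σ * (simple i * simple j * simple i) := by
          simp only [mul_assoc]
        rw [this, simple_braid hadj]
        simp only [mul_assoc, simple_mul_self, mul_one]
      rw [IH rfl li (by simp; omega) e1, IH (by omega) lj (by simp; omega) e2]
      exact hbraid i j hadj _
    · have h1 := inversions_mul_simple_add_one di
      have hq : j.castSucc ≠ i.succ := by simp [Fin.ext_iff]; omega
      have h2 : inversions (σ * simple i * simple j) + 1 = inversions (σ * simple i) := by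
        apply inversions_mul_simple_add_one
        rw [Equiv.Perm.mul_apply, Equiv.Perm.mul_apply, simple_of_ne hji' hjj, simple_of_ne hji hq]
        exact dj
      obtain ⟨y, hy, hyl⟩ := exists_word (σ * simple i * simple j)
      have e1 : wordPerm t = wordPerm (j :: y) := by
        rw [wordPerm_cons, hy, ei]
        simp only [mul_assoc, simple_mul_self, mul_one]
      have e2 : wordPerm t' = wordPerm (i :: y) := by
        rw [wordPerm_cons, hy, ej, mul_assoc σ, simple_comm hfar]
        simp only [mul_assoc, simple_mul_self, mul_one]
      rw [IH rfl li (by simp; omega) e1, IH (by omega) lj (by simp; omega) e2]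
      exact hcomm i j hfar _

end Words

/-! ### The inverse Hecke element of a permutation -/

section HeckePerm

variable {K : Type*} [Field K] {μ : YoungDiagram} {n : ℕ}

/-- The action on `V_μ` of the inverse of the Hecke element of the permutation `σ`. -/
def heckePermInv (μ : YoungDiagram) (s : K) (σ : Equiv.Perm (Fin (n + 1))) :
    V K μ n →ₗ[K] V K μ n :=
  (shortestWord σ).foldr (fun i A => heckeTInv μ s i ∘ₗ A) LinearMap.id

theorem foldr_comp_apply (s : K) (w : List (Fin n)) (u : V K μ n) :
    w.foldr (fun i A => heckeTInv μ s i ∘ₗ A) LinearMap.id u = heckeWordInv s w u := by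
  induction w with
  | nil => rfl
  | cons i w ih => simp only [heckeWordInv, List.foldr_cons, LinearMap.comp_apply] at ih ⊢; rw [ih]

theorem heckePermInv_apply (s : K) (σ : Equiv.Perm (Fin (n + 1))) (u : V K μ n) :
    heckePermInv μ s σ u = heckeWordInv s (shortestWord σ) u :=
  foldr_comp_apply s _ u

theorem heckeR_eq (s : K) (v : Fin (n + 1) → ℕ) (u : V K μ n) :
    heckeR s v u = heckePermInv μ s (rankPerm v) u :=
  (heckePermInv_apply s _ u).symm

theorem heckePermInv_eq {s : K} (hs0 : s ≠ 0) (hs : ∀ k : ℕ, 0 < k → s ^ k ≠ 1)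
    {σ : Equiv.Perm (Fin (n + 1))} {w : List (Fin n)} (hw : wordPerm w = σ)
    (hl : w.length = inversions σ) (u : V K μ n) :
    heckePermInv μ s σ u = heckeWordInv s w u := by
  have hσ : IsShortest (shortestWord σ) σ := Classical.choose_spec (exists_shortest σ)
  rw [heckePermInv_apply]
  refine foldr_eq_foldr_of_wordPerm_eq (fun i x => heckeTInv μ s i x)
    (fun i j hij x => heckeTInv_braid hs0 hs hij x) (fun i j hij x => heckeTInv_comm hs0 hs hij x)
    ?_ ?_ ?_ u
  · rw [hσ.1, hσ.length_eq]
  · rw [hσ.1, hl]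
  · rw [hσ.1, hw]

theorem heckePermInv_one {s : K} (hs0 : s ≠ 0) (hs : ∀ k : ℕ, 0 < k → s ^ k ≠ 1) (u : V K μ n) :
    heckePermInv μ s (1 : Equiv.Perm (Fin (n + 1))) u = u :=
  heckePermInv_eq hs0 hs (w := []) rfl inversions_one.symm u

theorem heckePermInv_mul_simple {s : K} (hs0 : s ≠ 0) (hs : ∀ k : ℕ, 0 < k → s ^ k ≠ 1)
    {σ : Equiv.Perm (Fin (n + 1))} {i : Fin n} (h : σ i.castSucc < σ i.succ) (u : V K μ n) :
    heckePermInv μ s (σ * simple i) u = heckeTInv μ s i (heckePermInv μ s σ u) := by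
  obtain ⟨w, hw, hl⟩ := exists_word σ
  rw [heckePermInv_eq hs0 hs hw hl, heckePermInv_eq hs0 hs (w := i :: w)]
  · rfl
  · rw [wordPerm_cons, hw]
  · rw [inversions_mul_simple h, List.length_cons, hl]

theorem heckeT_heckePermInv {s : K} (hs0 : s ≠ 0) (hs : ∀ k : ℕ, 0 < k → s ^ k ≠ 1)
    {σ : Equiv.Perm (Fin (n + 1))} {i : Fin n} (h : σ i.succ < σ i.castSucc) (u : V K μ n) :
    heckeT μ s i (heckePermInv μ s σ u) = heckePermInv μ s (σ * simple i) u := by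
  have h1 := heckePermInv_mul_simple (μ := μ) hs0 hs (σ := σ * simple i) (i := i)
    (by simpa [simple_castSucc, simple_succ] using h) u
  rw [mul_assoc, simple_mul_self, mul_one] at h1
  rw [h1, heckeT_heckeTInv hs0 hs]

/-- A generator can be moved past the Hecke element of `σ` if `σ` takes adjacent positions to
adjacent ones, in the same order. -/
theorem heckeT_heckePermInv_comm {s : K} (hs0 : s ≠ 0) (hs : ∀ k : ℕ, 0 < k → s ^ k ≠ 1)
    {σ : Equiv.Perm (Fin (n + 1))} {i j : Fin n} (h1 : σ i.castSucc = j.castSucc)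
    (h2 : σ i.succ = j.succ) (u : V K μ n) :
    heckeT μ s i (heckePermInv μ s σ u) = heckePermInv μ s σ (heckeT μ s j u) := by
  have key : ∀ u, heckeTInv μ s i (heckePermInv μ s σ u) =
      heckePermInv μ s σ (heckeTInv μ s j u) := by
    intro u
    have hlt : σ i.castSucc < σ i.succ := by
      rw [h1, h2]
      exact j.castSucc_lt_succ
    obtain ⟨w, hw, hl⟩ := exists_word σ
    rw [← heckePermInv_mul_simple hs0 hs hlt, heckePermInv_eq hs0 hs (w := w ++ [j]),
      heckePermInv_eq hs0 hs hw hl]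
    · simp [heckeWordInv]
    · rw [wordPerm_append_singleton, hw, simple, simple, Equiv.mul_swap_eq_swap_mul, h1, h2]
    · rw [inversions_mul_simple hlt, List.length_append, hl, List.length_singleton]
  rw [← heckeT_heckeTInv hs0 hs i (heckePermInv μ s σ (heckeT μ s j u)), key,
    heckeTInv_heckeT hs0 hs]

theorem heckePermInv_surjective {s : K} (hs0 : s ≠ 0) (hs : ∀ k : ℕ, 0 < k → s ^ k ≠ 1)
    (σ : Equiv.Perm (Fin (n + 1))) : Function.Surjective (heckePermInv μ s σ) := by
  have key : ∀ (w : List (Fin n)) (u : V K μ n), ∃ u', heckeWordInv s w u' = u := by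
    intro w
    induction w with
    | nil => exact fun u => ⟨u, rfl⟩
    | cons i w ih =>
      intro u
      obtain ⟨u', hu'⟩ := ih (heckeT μ s i u)
      refine ⟨u', ?_⟩
      change heckeTInv μ s i (heckeWordInv s w u') = u
      rw [hu', heckeTInv_heckeT hs0 hs]
  intro u
  obtain ⟨u', hu'⟩ := key (shortestWord σ) u
  exact ⟨u', by rw [heckePermInv_apply, hu']⟩

end HeckePerm

/-! ### The rank permutation along the moves of the graph -/

section RankMoves

variable {n : ℕ} (v : Fin (n + 1) → ℕ)

theorem rankPerm_lt_iff (i k : Fin (n + 1)) :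
    rankPerm v k < rankPerm v i ↔ (k < i ∧ v i ≤ v k) ∨ (i < k ∧ v i < v k) := by
  have e : ∀ j, ((rankPerm v j : Fin (n + 1)) : ℕ) = rankNat v j := fun _ => rfl
  rw [Fin.lt_def, e, e]
  refine ⟨fun h => ?_, rankNat_lt_of v⟩
  by_contra hn
  rcases lt_trichotomy i k with h' | h' | h'
  · have := rankNat_lt_of v (i := k) (k := i) (Or.inl ⟨h', by
      by_contra! h2; exact hn (Or.inr ⟨h', h2⟩)⟩)
    omega
  · subst h'; omega
  · have := rankNat_lt_of v (i := k) (k := i) (Or.inr ⟨h', by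
      by_contra! h2; exact hn (Or.inl ⟨h', h2⟩)⟩)
    omega

theorem rankPerm_castSucc_lt_succ {i : Fin n} :
    rankPerm v i.castSucc < rankPerm v i.succ ↔ v i.succ ≤ v i.castSucc := by
  rw [rankPerm_lt_iff]
  simp [i.castSucc_lt_succ, i.castSucc_lt_succ.not_gt]

theorem rankPerm_succ_lt_castSucc {i : Fin n} :
    rankPerm v i.succ < rankPerm v i.castSucc ↔ v i.castSucc < v i.succ := by
  rw [rankPerm_lt_iff]
  simp [i.castSucc_lt_succ, i.castSucc_lt_succ.not_gt]

theorem rankPerm_zero : rankPerm (fun _ : Fin (n + 1) => 0) = 1 :=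
  perm_eq_of_lt_iff fun a b => by rw [rankPerm_lt_iff]; simp

theorem rankPerm_comp_simple {i : Fin n} (h : v i.castSucc ≠ v i.succ) :
    rankPerm (v ∘ simple i) = rankPerm v * simple i := by
  refine perm_eq_of_lt_iff fun a b => ?_
  rw [Equiv.Perm.mul_apply, Equiv.Perm.mul_apply, rankPerm_lt_iff, rankPerm_lt_iff]
  simp only [Function.comp_apply]
  by_cases h1 : a = i.castSucc ∧ b = i.succ
  · rw [h1.1, h1.2, simple_castSucc, simple_succ]
    simp only [i.castSucc_lt_succ, i.castSucc_lt_succ.not_gt, true_and, false_and, or_false,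
      false_or]
    omega
  by_cases h2 : b = i.castSucc ∧ a = i.succ
  · rw [h2.1, h2.2, simple_castSucc, simple_succ]
    simp only [i.castSucc_lt_succ, i.castSucc_lt_succ.not_gt, true_and, false_and, or_false,
      false_or]
    omega
  rcases lt_trichotomy a b with hab | rfl | hab
  · have := RST.simple_lt hab h1
    simp [hab, hab.not_gt, this, this.not_gt]
  · simp
  · have := RST.simple_lt hab h2
    simp [hab, hab.not_gt, this, this.not_gt]

theorem rankPerm_succ_of_eq {i : Fin n} (h : v i.castSucc = v i.succ) :
    ((rankPerm v i.succ : Fin (n + 1)) : ℕ) = rankPerm v i.castSucc + 1 := by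
  have hlt := (rankPerm_castSucc_lt_succ v).mpr h.ge
  by_contra hne
  rw [Fin.lt_def] at hlt
  have hb : ((rankPerm v i.castSucc : Fin (n + 1)) : ℕ) + 1 < n + 1 := by
    have := (rankPerm v i.succ).2
    omega
  obtain ⟨a, ha⟩ := (rankPerm v).surjective ⟨rankPerm v i.castSucc + 1, hb⟩
  have h1 : rankPerm v i.castSucc < rankPerm v a := by rw [ha, Fin.lt_def]; simp
  have h2 : rankPerm v a < rankPerm v i.succ := by rw [ha, Fin.lt_def]; simp; omega
  rw [rankPerm_lt_iff] at h1 h2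
  simp only [Fin.lt_def, Fin.val_castSucc, Fin.val_succ] at h1 h2
  omega

/-- The affine move on exponents: `[a_1, …, a_N] ↦ [a_2, …, a_N, a_1 + 1]`. -/
def affineShift (a : Fin (n + 1) → ℕ) : Fin (n + 1) → ℕ := shift a (a 0 + 1)

theorem affineShift_castSucc (a : Fin (n + 1) → ℕ) (i : Fin n) :
    affineShift a i.castSucc = a i.succ := by
  simp [affineShift, shift]

theorem affineShift_last (a : Fin (n + 1) → ℕ) : affineShift a (Fin.last n) = a 0 + 1 := by
  simp [affineShift, shift]

theorem finRotate_castSucc (i : Fin n) : finRotate (n + 1) i.castSucc = i.succ := by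
  simp

theorem rankPerm_affineShift : rankPerm (affineShift v) = rankPerm v * finRotate (n + 1) := by
  refine perm_eq_of_lt_iff fun a b => ?_
  rw [Equiv.Perm.mul_apply, Equiv.Perm.mul_apply, rankPerm_lt_iff, rankPerm_lt_iff]
  induction a using Fin.lastCases with
  | last =>
    induction b using Fin.lastCases with
    | last => simp
    | cast b =>
      rw [affineShift_last, affineShift_castSucc, finRotate_castSucc, finRotate_last]
      simp only [Fin.castSucc_lt_last, (Fin.castSucc_lt_last b).not_gt, Fin.succ_pos,
        (Fin.succ_pos b).not_gt, true_and, false_and, false_or, or_false]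
      omega
  | cast a =>
    induction b using Fin.lastCases with
    | last =>
      rw [affineShift_last, affineShift_castSucc, finRotate_castSucc, finRotate_last]
      simp only [Fin.castSucc_lt_last, (Fin.castSucc_lt_last a).not_gt, Fin.succ_pos,
        (Fin.succ_pos a).not_gt, true_and, false_and, false_or, or_false]
      omega
    | cast b => simp [affineShift_castSucc]

end RankMoves

/-! ### An order on exponent vectors that is compatible with all moves -/

section Order

variable {n : ℕ}

/-- Place beads in a grid with rows `0, 1, 2, …` and columns `Fin (n + 1)`, with beads in the first
`v j` rows of column `j`. The beads are counted that lie in a row `> k`, or in row `k` and in one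
of the first `t` columns. When the grid is read from the top row down, the move `s_i` exchanges
neighbouring columns, and the affine move shifts everything by one place. -/
def beadCount (v : Fin (n + 1) → ℕ) (k t : ℕ) : ℕ :=
  ∑ j : Fin (n + 1), if (j : ℕ) < t then v j - k else v j - (k + 1)

/-- The order of bead diagrams: vectors of the same degree are compared through all their bead
counts. It is finer than `VecLE`. -/
def BeadLE (v' v : Fin (n + 1) → ℕ) : Prop :=
  ∑ j, v' j = ∑ j, v j ∧ ∀ k t, beadCount v' k t ≤ beadCount v k t

/-- The strict order of bead diagrams. -/
def BeadLT (v' v : Fin (n + 1) → ℕ) : Prop := BeadLE v' v ∧ v' ≠ v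

theorem beadCount_of_le (v : Fin (n + 1) → ℕ) (k : ℕ) {t : ℕ} (ht : n + 1 ≤ t) :
    beadCount v k t = ∑ j, (v j - k) :=
  Finset.sum_congr rfl fun j _ => if_pos (by omega)

theorem beadCount_succ (v : Fin (n + 1) → ℕ) (k : ℕ) (j : Fin (n + 1)) :
    beadCount v k (j + 1) = beadCount v k j + if k < v j then 1 else 0 := by
  have h : ∀ a : Fin (n + 1), (if (a : ℕ) < j + 1 then v a - k else v a - (k + 1)) =
      (if (a : ℕ) < j then v a - k else v a - (k + 1))
        + if a = j then (if k < v j then 1 else 0) else 0 := by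
    intro a
    by_cases ha : a = j
    · subst ha
      simp only [lt_add_iff_pos_right, zero_lt_one, if_true, lt_irrefl, if_false]
      split_ifs <;> omega
    · have : (a : ℕ) ≠ j := fun h => ha (Fin.ext h)
      simp only [if_neg ha, add_zero]
      split_ifs <;> omega
  rw [beadCount, Finset.sum_congr rfl fun a _ => h a, Finset.sum_add_distrib,
    Finset.sum_ite_eq' Finset.univ j]
  simp [beadCount]

theorem beadCount_eq_add (v : Fin (n + 1) → ℕ) (k : ℕ) (i : Fin (n + 1)) :
    beadCount v k (i + 1) =
      ∑ j, (v j - (k + 1)) + ∑ j ∈ Finset.Iic i, if k < v j then 1 else 0 := by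
  have h : ∀ a : Fin (n + 1), (if (a : ℕ) < i + 1 then v a - k else v a - (k + 1)) =
      (v a - (k + 1)) + if a ∈ Finset.Iic i then (if k < v a then 1 else 0) else 0 := by
    intro a
    simp only [Finset.mem_Iic, Fin.le_def]
    split_ifs <;> omega
  rw [beadCount, Finset.sum_congr rfl fun a _ => h a, Finset.sum_add_distrib, Finset.sum_ite_mem,
    Finset.univ_inter]

theorem BeadLE.refl (v : Fin (n + 1) → ℕ) : BeadLE v v := ⟨rfl, fun _ _ => le_rfl⟩

theorem BeadLE.trans {a b c : Fin (n + 1) → ℕ} (h : BeadLE a b) (h' : BeadLE b c) : BeadLE a c :=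
  ⟨h.1.trans h'.1, fun k t => (h.2 k t).trans (h'.2 k t)⟩

theorem BeadLE.antisymm {a b : Fin (n + 1) → ℕ} (h : BeadLE a b) (h' : BeadLE b a) : a = b := by
  have he : ∀ k t, beadCount a k t = beadCount b k t := fun k t => le_antisymm (h.2 k t) (h'.2 k t)
  funext j
  have key : ∀ k, k < a j ↔ k < b j := by
    intro k
    have h1 := beadCount_succ a k j
    have h2 := beadCount_succ b k j
    rw [he, he, h2] at h1
    split_ifs at h1 <;> omega
  exact le_antisymm (le_of_not_gt fun hlt => lt_irrefl _ ((key _).mp hlt))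
    (le_of_not_gt fun hlt => lt_irrefl _ ((key _).mpr hlt))

theorem BeadLE.trans_lt {a b c : Fin (n + 1) → ℕ} (h : BeadLE a b) (h' : BeadLT b c) :
    BeadLT a c :=
  ⟨h.trans h'.1, by rintro rfl; exact h'.2 (h'.1.antisymm h)⟩

theorem BeadLT.trans_le {a b c : Fin (n + 1) → ℕ} (h : BeadLT a b) (h' : BeadLE b c) :
    BeadLT a c :=
  ⟨h.1.trans h', by rintro rfl; exact h.2 (h.1.antisymm h')⟩

theorem sum_eq_add_add {p p' : Fin (n + 1)} (hp : p ≠ p') (f : Fin (n + 1) → ℕ) :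
    ∑ j, f j = f p + (f p' + ∑ j ∈ (Finset.univ.erase p).erase p', f j) := by
  rw [Finset.add_sum_erase _ _ (by simp [hp.symm]), Finset.add_sum_erase _ _ (by simp)]

/-- Replacing two entries, in positions `p < p'`, by two others with the same sum makes a vector
smaller if the old pair is decreasing and encloses the new one, or if it strictly encloses it. -/
theorem beadLE_of_pair {y z : Fin (n + 1) → ℕ} {p p' : Fin (n + 1)} (hp : p < p')
    (hyz : ∀ j, j ≠ p → j ≠ p' → y j = z j) (hsum : y p + y p' = z p + z p')
    (h : (z p' ≤ y p ∧ y p ≤ z p) ∨ (z p < y p ∧ y p < z p')) : BeadLE y z := by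
  have split := sum_eq_add_add hp.ne
  have hrest : ∀ j ∈ (Finset.univ.erase p).erase p', y j = z j := by
    intro j hj
    simp only [Finset.mem_erase] at hj
    exact hyz j hj.2.1 hj.1
  constructor
  · rw [split y, split z, Finset.sum_congr rfl hrest, ← add_assoc, hsum, add_assoc]
  · intro k t
    rw [beadCount, beadCount, split, split fun j => if (j : ℕ) < t then z j - k else z j - (k + 1),
      Finset.sum_congr rfl fun j hj => by rw [hrest j hj]]
    rw [Fin.lt_def] at hp
    rw [← add_assoc, ← add_assoc]
    refine Nat.add_le_add_right ?_ _
    split_ifs <;> omega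

theorem simple_val_lt_iff {i : Fin n} {t : ℕ} (ht : t ≠ i + 1) (j : Fin (n + 1)) :
    ((simple i j : Fin (n + 1)) : ℕ) < t ↔ (j : ℕ) < t := by
  simp only [simple, Equiv.swap_apply_def, Fin.ext_iff, Fin.val_castSucc, Fin.val_succ]
  split_ifs <;> simp only [Fin.val_castSucc, Fin.val_succ] <;> omega

theorem beadCount_comp_simple (v : Fin (n + 1) → ℕ) (k : ℕ) {i : Fin n} {t : ℕ}
    (ht : t ≠ i + 1) : beadCount (v ∘ simple i) k t = beadCount v k t :=
  Fintype.sum_equiv (simple i) _ _ fun j => by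
    simp only [Function.comp_apply, simple_val_lt_iff ht]

theorem sum_comp_simple (v : Fin (n + 1) → ℕ) (i : Fin n) : ∑ j, (v ∘ simple i) j = ∑ j, v j :=
  Equiv.sum_comp (simple i) v

/-- The larger one of `v` and `v s_i`. -/
def sortPair (i : Fin n) (v : Fin (n + 1) → ℕ) : Fin (n + 1) → ℕ :=
  if v i.castSucc < v i.succ then v ∘ simple i else v

theorem sortPair_le (i : Fin n) (v : Fin (n + 1) → ℕ) :
    sortPair i v i.succ ≤ sortPair i v i.castSucc := by
  unfold sortPair
  split_ifs with h
  · simpa [simple_castSucc, simple_succ] using h.le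
  · exact not_lt.mp h

theorem beadCount_sortPair (v : Fin (n + 1) → ℕ) (k : ℕ) {i : Fin n} {t : ℕ}
    (ht : t ≠ i + 1) : beadCount (sortPair i v) k t = beadCount v k t := by
  unfold sortPair
  split_ifs
  · exact beadCount_comp_simple v k ht
  · rfl

/-- The one bead count of `max(v, v s_i)` that may differ from that of `v` is a monotone function of
two others. -/
theorem beadCount_sortPair_eq_min (v : Fin (n + 1) → ℕ) (k : ℕ) (i : Fin n) :
    beadCount (sortPair i v) k (i + 1) = min (beadCount v k (i + 2)) (beadCount v k i + 1) := by
  have h1 := beadCount_succ (sortPair i v) k i.castSucc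
  have h2 := beadCount_succ (sortPair i v) k i.succ
  rw [Fin.val_castSucc] at h1
  rw [Fin.val_succ, show (i : ℕ) + 1 + 1 = i + 2 from rfl] at h2
  rw [beadCount_sortPair v k (t := i) (by omega)] at h1
  rw [beadCount_sortPair v k (t := i + 2) (by omega)] at h2
  have h3 := sortPair_le i v
  rw [h1] at h2 ⊢
  split_ifs at * <;> omega

/-- The lifting property: passing to the larger one of `v` and `v s_i` is monotone. -/
theorem BeadLE.sortPair {v' v : Fin (n + 1) → ℕ} (h : BeadLE v' v) (i : Fin n) :
    BeadLE (sortPair i v') (sortPair i v) := by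
  have hs : ∀ w : Fin (n + 1) → ℕ, ∑ j, VVMacdonald.sortPair i w j = ∑ j, w j := by
    intro w
    unfold VVMacdonald.sortPair
    split_ifs
    · exact sum_comp_simple w i
    · rfl
  refine ⟨by rw [hs, hs, h.1], fun k t => ?_⟩
  by_cases ht : t = i + 1
  · rw [ht, beadCount_sortPair_eq_min, beadCount_sortPair_eq_min]
    exact min_le_min (h.2 _ _) (Nat.add_le_add_right (h.2 _ _) 1)
  · rw [beadCount_sortPair _ _ ht, beadCount_sortPair _ _ ht]
    exact h.2 k t

theorem beadLE_comp_simple {v : Fin (n + 1) → ℕ} {i : Fin n} (h : v i.castSucc ≤ v i.succ) :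
    BeadLE v (v ∘ simple i) := by
  refine beadLE_of_pair i.castSucc_lt_succ (fun j h1 h2 => ?_) ?_ (Or.inl ?_)
  · simp [simple_of_ne h1 h2]
  · simp [simple_castSucc, simple_succ, add_comm]
  · simp [simple_castSucc, simple_succ, h]

theorem comp_simple_of_eq {v : Fin (n + 1) → ℕ} {i : Fin n} (h : v i.castSucc = v i.succ) :
    v ∘ simple i = v := by
  funext j
  rw [Function.comp_apply]
  by_cases h1 : j = i.castSucc
  · rw [h1, simple_castSucc, h]
  by_cases h2 : j = i.succ
  · rw [h2, simple_succ, h]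
  rw [simple_of_ne h1 h2]

theorem sum_affineShift (v : Fin (n + 1) → ℕ) : ∑ j, affineShift v j = ∑ j, v j + 1 := by
  rw [Fin.sum_univ_castSucc, Fin.sum_univ_succ, affineShift_last,
    Finset.sum_congr rfl fun j _ => affineShift_castSucc v j]
  omega

theorem beadCount_affineShift (v : Fin (n + 1) → ℕ) (k : ℕ) {t : ℕ} (ht : t ≤ n) :
    beadCount (affineShift v) k t = beadCount v k (t + 1) := by
  rw [beadCount, beadCount, Fin.sum_univ_castSucc, Fin.sum_univ_succ, affineShift_last]
  simp only [affineShift_castSucc, Fin.val_castSucc, Fin.val_succ, Fin.val_last,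
    add_lt_add_iff_right, if_neg ht.not_gt]
  rw [if_pos (show ((0 : Fin (n + 1)) : ℕ) < t + 1 from Nat.succ_pos t), Nat.add_sub_add_right,
    add_comm]

theorem beadCount_affineShift_last (v : Fin (n + 1) → ℕ) (k : ℕ) {t : ℕ} (ht : n + 1 ≤ t) :
    beadCount (affineShift v) (k + 1) t = beadCount v k 1 := by
  rw [beadCount_of_le _ _ ht, beadCount, Fin.sum_univ_castSucc, Fin.sum_univ_succ,
    affineShift_last]
  have h : ∀ x : Fin n, ¬ (x : ℕ) + 1 < 1 := fun x => by omega
  simp only [affineShift_castSucc, Fin.val_succ, if_neg (h _)]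
  rw [if_pos (show ((0 : Fin (n + 1)) : ℕ) < 1 from one_pos), Nat.add_sub_add_right, add_comm]

theorem BeadLE.affineShift {v' v : Fin (n + 1) → ℕ} (h : BeadLE v' v) :
    BeadLE (affineShift v') (affineShift v) := by
  have hsum : ∑ j, VVMacdonald.affineShift v' j = ∑ j, VVMacdonald.affineShift v j := by
    rw [sum_affineShift, sum_affineShift, h.1]
  refine ⟨hsum, fun k t => ?_⟩
  rcases le_or_gt t n with ht | ht
  · rw [beadCount_affineShift _ _ ht, beadCount_affineShift _ _ ht]
    exact h.2 _ _
  · cases k with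
    | zero =>
      rw [beadCount_of_le _ _ ht, beadCount_of_le _ _ ht]
      simpa using hsum.le
    | succ k =>
      rw [beadCount_affineShift_last _ _ ht, beadCount_affineShift_last _ _ ht]
      exact h.2 _ _

theorem affineShift_injective : Function.Injective (affineShift (n := n)) := by
  intro a b h
  funext j
  cases j using Fin.cases with
  | zero => simpa [affineShift_last] using congrFun h (Fin.last n)
  | succ j => simpa [affineShift_castSucc] using congrFun h j.castSucc

theorem BeadLT.affineShift {v' v : Fin (n + 1) → ℕ} (h : BeadLT v' v) :
    BeadLT (affineShift v') (affineShift v) :=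
  ⟨h.1.affineShift, affineShift_injective.ne h.2⟩

/-! ### Comparison with the dominance order -/

theorem sum_decr (v : Fin (n + 1) → ℕ) (f : ℕ → ℕ) : ∑ j, f (decr v j) = ∑ j, f (v j) :=
  Fintype.sum_equiv (Fin.revPerm.trans (Tuple.sort v)) _ _ fun _ => rfl

theorem decr_antitone (v : Fin (n + 1) → ℕ) : Antitone (decr v) := fun _ _ hab =>
  Tuple.monotone_sort v (Fin.rev_le_rev.mpr hab)

/-- Bead counts of full rows determine the partial sums of the decreasing rearrangement: the sum of
the first `i + 1` parts is the minimum over `k` of `(i + 1) k + ∑ (v_j - k)⁺`, attained at the part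
number `i + 1`. -/
theorem BeadLE.domLE_decr {v' v : Fin (n + 1) → ℕ} (h : BeadLE v' v) :
    DomLE (decr v') (decr v) := by
  intro i
  set k := decr v i with hk
  have h1 : ∑ j, (v' j - k) ≤ ∑ j, (v j - k) := by
    have := h.2 k (n + 1)
    rwa [beadCount_of_le _ _ le_rfl, beadCount_of_le _ _ le_rfl] at this
  rw [← sum_decr v' (fun x => x - k), ← sum_decr v (fun x => x - k)] at h1
  have h2 : ∑ j, (decr v j - k) = ∑ j ∈ Finset.Iic i, (decr v j - k) := by
    symm
    refine Finset.sum_subset (Finset.subset_univ _) fun j _ hj => ?_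
    rw [Finset.mem_Iic, not_le] at hj
    exact Nat.sub_eq_zero_of_le (decr_antitone v hj.le)
  calc ∑ j ∈ Finset.Iic i, decr v' j
      ≤ ∑ j ∈ Finset.Iic i, ((decr v' j - k) + k) :=
        Finset.sum_le_sum fun j _ => by omega
    _ = ∑ j ∈ Finset.Iic i, (decr v' j - k) + ∑ j ∈ Finset.Iic i, k := Finset.sum_add_distrib
    _ ≤ ∑ j, (decr v' j - k) + ∑ j ∈ Finset.Iic i, k :=
        Nat.add_le_add_right (Finset.sum_le_sum_of_subset (Finset.subset_univ _)) _
    _ ≤ ∑ j ∈ Finset.Iic i, (decr v j - k) + ∑ j ∈ Finset.Iic i, k :=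
        Nat.add_le_add_right (h1.trans_eq h2) _
    _ = ∑ j ∈ Finset.Iic i, ((decr v j - k) + k) := Finset.sum_add_distrib.symm
    _ = ∑ j ∈ Finset.Iic i, decr v j := Finset.sum_congr rfl fun j hj => by
        have := decr_antitone v (Finset.mem_Iic.mp hj)
        omega

theorem BeadLE.domLE {v' v : Fin (n + 1) → ℕ} (h : BeadLE v' v) (hd : decr v' = decr v) :
    DomLE v' v := by
  intro i
  have h1 : ∀ k, ∑ j ∈ Finset.Iic i, (if k < v' j then 1 else 0) ≤
      ∑ j ∈ Finset.Iic i, if k < v j then 1 else 0 := by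
    intro k
    have h2 := h.2 k (i + 1)
    rw [beadCount_eq_add, beadCount_eq_add, ← sum_decr v' (fun x => x - (k + 1)), hd,
      sum_decr v (fun x => x - (k + 1))] at h2
    omega
  have h3 : ∀ (w : Fin (n + 1) → ℕ) (B : ℕ), ∑ j, w j ≤ B → ∑ j ∈ Finset.Iic i, w j =
      ∑ k ∈ Finset.range B, ∑ j ∈ Finset.Iic i, if k < w j then 1 else 0 := by
    intro w B hB
    rw [Finset.sum_comm]
    refine Finset.sum_congr rfl fun j _ => ?_
    have h4 : w j ≤ B :=
      (Finset.single_le_sum (fun _ _ => Nat.zero_le _) (Finset.mem_univ j)).trans hB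
    have h5 : (Finset.range B).filter (fun k => k < w j) = Finset.range (w j) := by
      ext k
      simp only [Finset.mem_filter, Finset.mem_range]
      omega
    rw [← Finset.card_filter, h5, Finset.card_range]
  rw [h3 v' _ h.1.le, h3 v _ le_rfl]
  exact Finset.sum_le_sum fun k _ => h1 k

theorem BeadLT.vecLT {v' v : Fin (n + 1) → ℕ} (h : BeadLT v' v) : VecLT v' v :=
  ⟨h.2, fun _ => h.1.domLE_decr, h.1.domLE⟩

end Order

/-! ### The operators on monomials -/

section MonomialAction

variable {K : Type*} [Field K] {μ : YoungDiagram} {n : ℕ}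

/-- The monomial `x^v`. -/
def expMonomial (K : Type*) [Field K] (v : Fin (n + 1) → ℕ) : MvPolynomial (Fin (n + 1)) K :=
  monomial (Finsupp.equivFunOnFinite.symm v) 1

/-- The vector valued polynomials all of whose exponents lie in `S`. -/
def exponentsIn (K : Type*) [Field K] (μ : YoungDiagram) (S : Set (Fin (n + 1) → ℕ)) :
    Submodule K (M K μ n) :=
  Submodule.span K {m | ∃ w ∈ S, ∃ u : V K μ n, m = expMonomial K w ⊗ₜ u}

theorem tmul_mem_exponentsIn {S : Set (Fin (n + 1) → ℕ)} {w : Fin (n + 1) → ℕ} (hw : w ∈ S)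
    (u : V K μ n) : expMonomial K w ⊗ₜ u ∈ exponentsIn K μ S :=
  Submodule.subset_span ⟨w, hw, u, rfl⟩

theorem exponentsIn_mono {S S' : Set (Fin (n + 1) → ℕ)} (h : S ⊆ S') :
    exponentsIn K μ S ≤ exponentsIn K μ S' :=
  Submodule.span_mono fun _ ⟨w, hw, u, hm⟩ => ⟨w, h hw, u, hm⟩

theorem map_mem_of_mem_exponentsIn {S : Set (Fin (n + 1) → ℕ)} (A : M K μ n →ₗ[K] M K μ n)
    {W : Submodule K (M K μ n)} (h : ∀ w ∈ S, ∀ u : V K μ n, A (expMonomial K w ⊗ₜ u) ∈ W)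
    {P : M K μ n} (hP : P ∈ exponentsIn K μ S) : A P ∈ W := by
  have : exponentsIn K μ S ≤ W.comap A := by
    refine Submodule.span_le.mpr ?_
    rintro _ ⟨w, hw, u, rfl⟩
    exact h w hw u
  exact this hP

theorem varSwap_expMonomial (i : Fin n) (v : Fin (n + 1) → ℕ) :
    varSwap i (expMonomial K v) = expMonomial K (v ∘ simple i) := by
  have h : Finsupp.mapDomain (simple i) (Finsupp.equivFunOnFinite.symm v) =
      Finsupp.equivFunOnFinite.symm (v ∘ simple i) := by
    ext j
    rw [Finsupp.mapDomain_equiv_apply]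
    rfl
  rw [varSwap, expMonomial, rename_monomial, expMonomial, h]

/-- The vector `v` with its entries in the positions exchanged by `s_i` replaced by `c` and `d`. -/
def setPair (i : Fin n) (v : Fin (n + 1) → ℕ) (c d : ℕ) : Fin (n + 1) → ℕ := fun j =>
  if j = i.castSucc then c else if j = i.succ then d else v j

theorem setPair_castSucc (i : Fin n) (v : Fin (n + 1) → ℕ) (c d : ℕ) :
    setPair i v c d i.castSucc = c := if_pos rfl

theorem setPair_succ (i : Fin n) (v : Fin (n + 1) → ℕ) (c d : ℕ) :
    setPair i v c d i.succ = d := by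
  rw [setPair, if_neg i.castSucc_lt_succ.ne', if_pos rfl]

theorem setPair_of_ne {i : Fin n} {j : Fin (n + 1)} (h1 : j ≠ i.castSucc) (h2 : j ≠ i.succ)
    (v : Fin (n + 1) → ℕ) (c d : ℕ) : setPair i v c d j = v j := by
  rw [setPair, if_neg h1, if_neg h2]

theorem eq_setPair {i : Fin n} {v w : Fin (n + 1) → ℕ}
    (h : ∀ j, j ≠ i.castSucc → j ≠ i.succ → w j = v j) :
    w = setPair i v (w i.castSucc) (w i.succ) := by
  funext j
  unfold setPair
  split_ifs with h1 h2
  · rw [h1]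
  · rw [h2]
  · exact h j h1 h2

theorem comp_simple_eq_setPair (i : Fin n) (v : Fin (n + 1) → ℕ) :
    v ∘ simple i = setPair i v (v i.succ) (v i.castSucc) := by
  have h := eq_setPair (i := i) (v := v) (w := v ∘ simple i) fun j h1 h2 => by
    rw [Function.comp_apply, simple_of_ne h1 h2]
  rwa [Function.comp_apply, Function.comp_apply, simple_castSucc, simple_succ] at h

theorem expMonomial_setPair (i : Fin n) (v : Fin (n + 1) → ℕ) (c d : ℕ) :
    expMonomial K (setPair i v c d) =
      expMonomial K (setPair i v 0 0) * X i.castSucc ^ c * X i.succ ^ d := by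
  rw [expMonomial, expMonomial, X_pow_eq_monomial, X_pow_eq_monomial, monomial_mul, monomial_mul,
    mul_one, mul_one]
  refine congrArg (fun e => monomial e (1 : K)) ?_
  ext j
  simp only [Finsupp.add_apply, Finsupp.equivFunOnFinite_symm_apply_apply, Finsupp.single_apply]
  by_cases h1 : j = i.castSucc
  · subst h1
    rw [setPair_castSucc, setPair_castSucc, if_pos rfl, if_neg i.castSucc_lt_succ.ne']
    omega
  by_cases h2 : j = i.succ
  · subst h2
    rw [setPair_succ, setPair_succ, if_pos rfl, if_neg i.castSucc_lt_succ.ne]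
    omega
  rw [setPair_of_ne h1 h2, setPair_of_ne h1 h2, if_neg (Ne.symm h1), if_neg (Ne.symm h2)]
  omega

/-- The sum of the monomials whose exponents in the two positions exchanged by `s_i` run through
`(c, c + m), (c + 1, c + m - 1), …, (c + m - 1, c + 1)`. -/
def monomialChain (K : Type*) [Field K] (i : Fin n) (v : Fin (n + 1) → ℕ) (c m : ℕ) :
    MvPolynomial (Fin (n + 1)) K :=
  ∑ k ∈ Finset.range m, expMonomial K (setPair i v (c + k) (c + m - k))

theorem X_sub_X_mul_monomialChain (i : Fin n) (v : Fin (n + 1) → ℕ) (c m : ℕ) :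
    (X i.castSucc - X i.succ) * monomialChain K i v c m =
      X i.succ *
        (expMonomial K (setPair i v (c + m) c) - expMonomial K (setPair i v c (c + m))) := by
  have h1 : monomialChain K i v c m = X i.succ * (expMonomial K (setPair i v 0 0)
      * X i.castSucc ^ c * X i.succ ^ c *
        ∑ k ∈ Finset.range m, X i.castSucc ^ k * X i.succ ^ (m - 1 - k)) := by
    rw [monomialChain, Finset.mul_sum, Finset.mul_sum]
    refine Finset.sum_congr rfl fun k hk => ?_
    rw [Finset.mem_range] at hk
    rw [expMonomial_setPair, show c + m - k = c + (m - 1 - k) + 1 by omega, pow_add, pow_add,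
      pow_add]
    ring
  have h2 := (Commute.all (X i.castSucc : MvPolynomial (Fin (n + 1)) K) (X i.succ)).geom_sum₂_mul m
  rw [h1, expMonomial_setPair i v (c + m), expMonomial_setPair i v c (c + m), pow_add, pow_add]
  linear_combination (X i.succ * expMonomial K (setPair i v 0 0)
      * X i.castSucc ^ c * X i.succ ^ c) * h2

theorem delta_setPair_of_le (s : K) (i : Fin n) (v : Fin (n + 1) → ℕ) (c m : ℕ) :
    delta s i (expMonomial K (setPair i v (c + m) c)) = (1 - s) • monomialChain K i v c m := by
  rw [delta, LinearMap.smul_apply, LinearMap.comp_apply, LinearMap.mulLeft_apply]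
  congr 1
  apply mul_left_cancel₀ (X_sub_X_ne_zero (K := K) i)
  rw [X_sub_X_mul_monomialChain, mul_left_comm]
  congr 1
  refine (dividedDiffFun_spec i _).trans ?_
  rw [varSwap_expMonomial, comp_simple_eq_setPair, setPair_castSucc, setPair_succ]
  congr 2
  funext j
  unfold setPair
  split_ifs <;> rfl

theorem delta_setPair_of_ge (s : K) (i : Fin n) (v : Fin (n + 1) → ℕ) (c m : ℕ) :
    delta s i (expMonomial K (setPair i v c (c + m))) = -((1 - s) • monomialChain K i v c m) := by
  rw [delta, LinearMap.smul_apply, LinearMap.comp_apply, LinearMap.mulLeft_apply, ← smul_neg]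
  congr 1
  apply mul_left_cancel₀ (X_sub_X_ne_zero (K := K) i)
  rw [mul_neg, X_sub_X_mul_monomialChain, mul_left_comm, ← mul_neg, neg_sub]
  congr 1
  refine (dividedDiffFun_spec i _).trans ?_
  rw [varSwap_expMonomial, comp_simple_eq_setPair, setPair_castSucc, setPair_succ]
  congr 2
  funext j
  unfold setPair
  split_ifs <;> rfl

/-- The vectors obtained from `v` by moving its entries in the positions exchanged by `s_i` strictly
closer together. -/
def interiorPairs (i : Fin n) (v : Fin (n + 1) → ℕ) : Set (Fin (n + 1) → ℕ) :=
  {w | (∀ j, j ≠ i.castSucc → j ≠ i.succ → w j = v j) ∧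
    w i.castSucc + w i.succ = v i.castSucc + v i.succ ∧
    min (v i.castSucc) (v i.succ) < w i.castSucc ∧ w i.castSucc < max (v i.castSucc) (v i.succ)}

theorem monomialChain_tmul_sub_mem (i : Fin n) (v : Fin (n + 1) → ℕ) {c m : ℕ} (hm : 0 < m)
    (h : (v i.castSucc = c ∧ v i.succ = c + m) ∨ (v i.castSucc = c + m ∧ v i.succ = c))
    (u : V K μ n) :
    monomialChain K i v c m ⊗ₜ u - expMonomial K (setPair i v c (c + m)) ⊗ₜ u
      ∈ exponentsIn K μ (interiorPairs i v) := by
  obtain ⟨m, rfl⟩ := Nat.exists_eq_succ_of_ne_zero hm.ne'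
  rw [monomialChain, Finset.sum_range_succ', add_zero, Nat.sub_zero, TensorProduct.add_tmul,
    add_sub_cancel_right, TensorProduct.sum_tmul]
  refine Submodule.sum_mem _ fun k hk => tmul_mem_exponentsIn ?_ u
  rw [Finset.mem_range] at hk
  refine ⟨fun j h1 h2 => setPair_of_ne h1 h2 _ _ _, ?_⟩
  rw [setPair_castSucc, setPair_succ]
  omega

theorem boldT_tmul (s : K) (i : Fin n) (v : Fin (n + 1) → ℕ) (u : V K μ n) :
    boldT μ s i (expMonomial K v ⊗ₜ u) =
      delta s i (expMonomial K v) ⊗ₜ u + expMonomial K (v ∘ simple i) ⊗ₜ heckeT μ s i u := by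
  simp [boldT, varSwap_expMonomial]

theorem boldTInv_tmul (s : K) (i : Fin n) (v : Fin (n + 1) → ℕ) (u : V K μ n) :
    boldTInv μ s i (expMonomial K v ⊗ₜ u) =
      s⁻¹ • (delta s i (expMonomial K v) ⊗ₜ u + expMonomial K (v ∘ simple i) ⊗ₜ heckeT μ s i u
        + (1 - s) • expMonomial K v ⊗ₜ u) := by
  rw [← boldT_tmul]
  rfl

theorem delta_tmul_of_lt (s : K) {i : Fin n} {v : Fin (n + 1) → ℕ}
    (h : v i.castSucc < v i.succ) (u : V K μ n) :
    delta s i (expMonomial K v) ⊗ₜ u + (1 - s) • expMonomial K v ⊗ₜ u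
      ∈ exponentsIn K μ (interiorPairs i v) := by
  obtain ⟨m, hm⟩ := Nat.exists_eq_add_of_lt h
  have hv := eq_setPair (i := i) (v := v) (w := v) fun _ _ _ => rfl
  rw [show v i.succ = v i.castSucc + (m + 1) by omega] at hv
  have h1 := monomialChain_tmul_sub_mem (K := K) (μ := μ) i v (c := v i.castSucc) (m := m + 1)
    (Nat.succ_pos m) (Or.inl ⟨rfl, by omega⟩) u
  have h2 := delta_setPair_of_ge s i v (v i.castSucc) (m + 1)
  rw [← hv] at h1 h2
  rw [h2, TensorProduct.neg_tmul, ← TensorProduct.smul_tmul', neg_add_eq_sub, ← neg_sub]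
  have h3 := Submodule.smul_mem _ (1 - s) h1
  rw [smul_sub] at h3
  exact Submodule.neg_mem _ h3

theorem delta_tmul_of_gt (s : K) {i : Fin n} {v : Fin (n + 1) → ℕ}
    (h : v i.succ < v i.castSucc) (u : V K μ n) :
    delta s i (expMonomial K v) ⊗ₜ u - (1 - s) • expMonomial K (v ∘ simple i) ⊗ₜ u
      ∈ exponentsIn K μ (interiorPairs i v) := by
  obtain ⟨m, hm⟩ := Nat.exists_eq_add_of_lt h
  have hv := eq_setPair (i := i) (v := v) (w := v) fun _ _ _ => rfl
  have hv' := comp_simple_eq_setPair i v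
  rw [show v i.castSucc = v i.succ + (m + 1) by omega] at hv hv'
  have h1 := monomialChain_tmul_sub_mem (K := K) (μ := μ) i v (c := v i.succ) (m := m + 1)
    (Nat.succ_pos m) (Or.inr ⟨by omega, rfl⟩) u
  have h2 := delta_setPair_of_le s i v (v i.succ) (m + 1)
  rw [← hv'] at h1
  rw [← hv] at h2
  rw [h2, ← TensorProduct.smul_tmul']
  have h3 := Submodule.smul_mem _ (1 - s) h1
  rwa [smul_sub] at h3

theorem delta_of_eq (s : K) {i : Fin n} {v : Fin (n + 1) → ℕ} (h : v i.castSucc = v i.succ) :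
    delta s i (expMonomial K v) = 0 := by
  have hv := eq_setPair (i := i) (v := v) (w := v) fun _ _ _ => rfl
  have h2 := delta_setPair_of_le s i v (v i.succ) 0
  rw [h] at hv
  rw [add_zero, ← hv] at h2
  rw [h2, monomialChain, Finset.range_zero, Finset.sum_empty, smul_zero]

theorem boldT_tmul_sub_mem (s : K) {i : Fin n} {v : Fin (n + 1) → ℕ}
    (h : v i.castSucc ≤ v i.succ) (u : V K μ n) :
    boldT μ s i (expMonomial K v ⊗ₜ u) - expMonomial K (v ∘ simple i) ⊗ₜ heckeT μ s i u
      ∈ exponentsIn K μ (insert v (interiorPairs i v)) := by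
  rw [boldT_tmul, add_sub_cancel_right]
  rcases h.lt_or_eq with h | h
  · have h1 := exponentsIn_mono (Set.subset_insert v _) (delta_tmul_of_lt s h u)
    exact (Submodule.add_mem_iff_left _ (Submodule.smul_mem _ _
      (tmul_mem_exponentsIn (Set.mem_insert v _) u))).mp h1
  · rw [delta_of_eq s h, TensorProduct.zero_tmul]
    exact Submodule.zero_mem _

theorem boldT_tmul_mem (s : K) (i : Fin n) (v : Fin (n + 1) → ℕ) (u : V K μ n) :
    boldT μ s i (expMonomial K v ⊗ₜ u)
      ∈ exponentsIn K μ (insert (v ∘ simple i) (insert v (interiorPairs i v))) := by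
  have h0 : ∀ u', expMonomial K (v ∘ simple i) ⊗ₜ u' ∈
      exponentsIn K μ (insert (v ∘ simple i) (insert v (interiorPairs i v))) := fun u' =>
    tmul_mem_exponentsIn (Set.mem_insert _ _) u'
  rcases le_or_gt (v i.castSucc) (v i.succ) with h | h
  · exact (Submodule.sub_mem_iff_left _ (h0 _)).mp
      (exponentsIn_mono (Set.subset_insert _ _) (boldT_tmul_sub_mem s h u))
  · rw [boldT_tmul]
    refine Submodule.add_mem _ ?_ (h0 _)
    exact (Submodule.sub_mem_iff_left _ (Submodule.smul_mem _ (1 - s) (h0 u))).mp (exponentsIn_mono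
      ((Set.subset_insert _ _).trans (Set.subset_insert _ _)) (delta_tmul_of_gt s h u))

theorem interiorPairs_beadLE {i : Fin n} {v w : Fin (n + 1) → ℕ} (hw : w ∈ interiorPairs i v) :
    BeadLE w (sortPair i v) := by
  obtain ⟨h1, h2, h3, h4⟩ := hw
  unfold sortPair
  split_ifs with h
  · rw [min_eq_left h.le] at h3
    rw [max_eq_right h.le] at h4
    refine beadLE_of_pair i.castSucc_lt_succ (fun j hj1 hj2 => ?_) ?_ (Or.inl ?_)
    · rw [h1 j hj1 hj2, Function.comp_apply, simple_of_ne hj1 hj2]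
    · simp only [Function.comp_apply, simple_castSucc, simple_succ]
      omega
    · simp only [Function.comp_apply, simple_castSucc, simple_succ]
      exact ⟨h3.le, h4.le⟩
  · rw [not_lt] at h
    rw [min_eq_right h] at h3
    rw [max_eq_left h] at h4
    exact beadLE_of_pair i.castSucc_lt_succ h1 h2 (Or.inl ⟨h3.le, h4.le⟩)

theorem beadLE_sortPair (i : Fin n) (v : Fin (n + 1) → ℕ) : BeadLE v (sortPair i v) := by
  unfold sortPair
  split_ifs with h
  · exact beadLE_comp_simple h.le
  · exact BeadLE.refl v

theorem comp_simple_comp_simple (i : Fin n) (v : Fin (n + 1) → ℕ) :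
    (v ∘ simple i) ∘ simple i = v := by
  funext j
  simp [simple_simple]

theorem comp_simple_beadLE_sortPair (i : Fin n) (v : Fin (n + 1) → ℕ) :
    BeadLE (v ∘ simple i) (sortPair i v) := by
  unfold sortPair
  split_ifs with h
  · exact BeadLE.refl _
  · have := beadLE_comp_simple (v := v ∘ simple i) (i := i)
      (by simpa [simple_castSucc, simple_succ] using h)
    rwa [comp_simple_comp_simple] at this

theorem sortPair_of_le {i : Fin n} {v : Fin (n + 1) → ℕ} (h : v i.castSucc ≤ v i.succ) :
    sortPair i v = v ∘ simple i := by
  unfold sortPair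
  split_ifs with h'
  · rfl
  · rw [comp_simple_of_eq (le_antisymm h (not_lt.mp h'))]

/-- If `v ≤ v s_i`, then `𝐓_i` takes terms below `v` to terms below `v s_i`. -/
theorem boldT_mem_of_mem (s : K) {i : Fin n} {v : Fin (n + 1) → ℕ}
    (h : v i.castSucc ≤ v i.succ) {P : M K μ n} (hP : P ∈ exponentsIn K μ {w | BeadLT w v}) :
    boldT μ s i P ∈ exponentsIn K μ {w | BeadLT w (v ∘ simple i)} := by
  refine map_mem_of_mem_exponentsIn (boldT μ s i) (fun w hw u => ?_) hP
  have hlt : BeadLT (sortPair i w) (v ∘ simple i) := by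
    have h1 := hw.1.sortPair i
    rw [sortPair_of_le h] at h1
    refine ⟨h1, fun heq => ?_⟩
    have h2 := beadLE_comp_simple h
    unfold sortPair at heq
    split_ifs at heq with hlt
    · refine hw.2 ?_
      rw [← comp_simple_comp_simple i w, heq, comp_simple_comp_simple]
    · exact hw.2 (hw.1.antisymm (heq ▸ h2))
  refine exponentsIn_mono ?_ (boldT_tmul_mem s i w u)
  rintro w' (rfl | rfl | hw')
  · exact (comp_simple_beadLE_sortPair i w).trans_lt hlt
  · exact (beadLE_sortPair i w').trans_lt hlt
  · exact (interiorPairs_beadLE hw').trans_lt hlt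

end MonomialAction

/-! ### The raising operator -/

section Raising

variable {K : Type*} [Field K] {μ : YoungDiagram} {n : ℕ}

/-- The vector obtained from `a` by moving the entry in position `p` to the end and increasing it by
one. It is what becomes of an exponent `a` in the raising operator if the entry in position `p` is
carried along to the end, as happens for the leading term. -/
def affineAt (p : Fin (n + 1)) (a : Fin (n + 1) → ℕ) : Fin (n + 1) → ℕ :=
  Fin.snoc (α := fun _ => ℕ) (fun j : Fin n => a (p.succAbove j)) (a p + 1)

theorem affineAt_castSucc (p : Fin (n + 1)) (a : Fin (n + 1) → ℕ) (j : Fin n) :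
    affineAt p a j.castSucc = a (p.succAbove j) := by
  simp [affineAt]

theorem affineAt_last_apply (p : Fin (n + 1)) (a : Fin (n + 1) → ℕ) :
    affineAt p a (Fin.last n) = a p + 1 := by
  simp [affineAt]

theorem affineAt_zero (a : Fin (n + 1) → ℕ) : affineAt 0 a = affineShift a := by
  simp [affineAt, affineShift, shift]

theorem simple_succAbove (i j : Fin n) :
    simple i (i.succ.succAbove j) = i.castSucc.succAbove j := by
  simp only [simple, Equiv.swap_apply_def, Fin.succAbove, Fin.lt_def, Fin.ext_iff, Fin.val_castSucc,
    Fin.val_succ]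
  split_ifs <;> simp only [Fin.val_castSucc, Fin.val_succ] at * <;> omega

theorem affineAt_succ_comp_simple (i : Fin n) (a : Fin (n + 1) → ℕ) :
    affineAt i.succ (a ∘ simple i) = affineAt i.castSucc a := by
  funext j
  induction j using Fin.lastCases with
  | last => rw [affineAt_last_apply, affineAt_last_apply, Function.comp_apply, simple_succ]
  | cast j => rw [affineAt_castSucc, affineAt_castSucc, Function.comp_apply, simple_succAbove]

/-- In one step of the raising operator, all terms other than the leading one stay below it, when
exponents are compared after the remaining steps have been carried out. -/
theorem affineAt_beadLT {i : Fin n} {a w : Fin (n + 1) → ℕ}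
    (hw : ∀ j, j ≠ i.castSucc → j ≠ i.succ → w j = a j)
    (hsum : w i.castSucc + w i.succ = a i.castSucc + a i.succ)
    (h : (a i.castSucc < w i.castSucc ∧ w i.castSucc < a i.succ) ∨
      (a i.succ < w i.castSucc ∧ w i.castSucc ≤ a i.castSucc)) :
    BeadLT (affineAt i.succ w) (affineAt i.castSucc a) := by
  have hi : i.succ.succAbove i = i.castSucc := by simp
  have h1 : affineAt i.castSucc a i.castSucc = a i.succ := by simp [affineAt_castSucc]
  have h2 : affineAt i.succ w i.castSucc = w i.castSucc := by rw [affineAt_castSucc, hi]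
  constructor
  · refine beadLE_of_pair (Fin.castSucc_lt_last i) (fun j hj1 hj2 => ?_) ?_ ?_
    · induction j using Fin.lastCases with
      | last => exact absurd rfl hj2
      | cast j =>
        rw [← affineAt_succ_comp_simple, affineAt_castSucc, affineAt_castSucc, Function.comp_apply]
        have hji : i.succ.succAbove j ≠ i.castSucc := by
          rw [← hi]
          exact fun h => hj1 (congrArg _ (Fin.succAbove_right_injective h))
        have hji' : i.succ.succAbove j ≠ i.succ := Fin.succAbove_ne _ _
        rw [hw _ hji hji', simple_of_ne hji hji']
    · rw [h1, h2, affineAt_last_apply, affineAt_last_apply]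
      omega
    · rw [h1, h2, affineAt_last_apply]
      omega
  · intro heq
    have := congrFun heq i.castSucc
    rw [h1, h2] at this
    omega

theorem boldTInv_tmul_sub_mem {s : K} (i : Fin n) (a : Fin (n + 1) → ℕ) (u : V K μ n) :
    boldTInv μ s i (expMonomial K a ⊗ₜ u) - expMonomial K (a ∘ simple i) ⊗ₜ
        (if a i.castSucc < a i.succ then s⁻¹ • heckeT μ s i u else heckeTInv μ s i u)
      ∈ exponentsIn K μ {w | BeadLT (affineAt i.succ w) (affineAt i.castSucc a)} := by
  have hsub : interiorPairs i a ⊆ {w | BeadLT (affineAt i.succ w) (affineAt i.castSucc a)} := by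
    rintro w ⟨h1, h2, h3, h4⟩
    refine affineAt_beadLT h1 h2 ?_
    omega
  rw [boldTInv_tmul]
  rcases lt_trichotomy (a i.castSucc) (a i.succ) with h | h | h
  · have h1 := Submodule.smul_mem _ s⁻¹ (exponentsIn_mono hsub (delta_tmul_of_lt s h u))
    rw [if_pos h, TensorProduct.tmul_smul]
    convert h1 using 1
    module
  · rw [if_neg h.not_lt, delta_of_eq s h, comp_simple_of_eq h, heckeTInv_apply,
      TensorProduct.tmul_smul, TensorProduct.tmul_add, TensorProduct.tmul_smul,
      TensorProduct.zero_tmul, zero_add, sub_self]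
    exact Submodule.zero_mem _
  · have h1 := Submodule.smul_mem _ s⁻¹ (exponentsIn_mono hsub (delta_tmul_of_gt s h u))
    have h2 : a ∈ {w | BeadLT (affineAt i.succ w) (affineAt i.castSucc a)} :=
      affineAt_beadLT (fun _ _ _ => rfl) rfl (Or.inr ⟨h, le_rfl⟩)
    have h3 := Submodule.add_mem _ h1
      (Submodule.smul_mem _ (s⁻¹ * (1 - s)) (tmul_mem_exponentsIn (K := K) (μ := μ) h2 u))
    rw [if_neg h.not_gt, heckeTInv_apply, TensorProduct.tmul_smul, TensorProduct.tmul_add,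
      TensorProduct.tmul_smul]
    convert h3 using 1
    module

theorem boldTInv_mem_of_mem {s : K} {i : Fin n} {b : Fin (n + 1) → ℕ} {P : M K μ n}
    (hP : P ∈ exponentsIn K μ {w | BeadLT (affineAt i.castSucc w) b}) :
    boldTInv μ s i P ∈ exponentsIn K μ {w | BeadLT (affineAt i.succ w) b} := by
  refine map_mem_of_mem_exponentsIn (boldTInv μ s i) (fun w hw u => ?_) hP
  refine (Submodule.sub_mem_iff_left _ (tmul_mem_exponentsIn ?_ _)).mp
    (exponentsIn_mono (fun w' hw' => ?_) (boldTInv_tmul_sub_mem i w u))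
  · change BeadLT _ _
    rw [affineAt_succ_comp_simple]
    exact hw
  · exact hw'.1.trans_lt hw

/-- The leading term after the first `m` steps of the raising operator. The cycle `τ` collects the
simple transpositions of these steps. -/
theorem foldl_boldTInv_leading {s : K} (hs0 : s ≠ 0) (hs : ∀ k : ℕ, 0 < k → s ^ k ≠ 1)
    {v : Fin (n + 1) → ℕ} {e : V K μ n} {P : M K μ n} {c : K} (hc : c ≠ 0)
    (hP : P - expMonomial K v ⊗ₜ (c • heckePermInv μ s (rankPerm v) e) ∈
      exponentsIn K μ {w | BeadLT w v}) (m : ℕ) (hm : m < n + 1) :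
    ∃ (τ : Equiv.Perm (Fin (n + 1))) (c' : K), c' ≠ 0 ∧ τ ⟨m, hm⟩ = 0 ∧
      (∀ j : Fin (n + 1), m < j → τ j = j) ∧ (∀ j : Fin n, (j : ℕ) < m → τ j.castSucc = j.succ) ∧
      affineAt ⟨m, hm⟩ (v ∘ τ) = affineShift v ∧
      ((List.finRange n).take m).foldl (fun Q i => boldTInv μ s i Q) P
          - expMonomial K (v ∘ τ) ⊗ₜ (c' • heckePermInv μ s (rankPerm v * τ) e) ∈
        exponentsIn K μ {w | BeadLT (affineAt ⟨m, hm⟩ w) (affineShift v)} := by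
  induction m with
  | zero =>
    refine ⟨1, c, hc, rfl, fun _ _ => rfl, fun j hj => absurd hj (by omega), affineAt_zero v, ?_⟩
    refine exponentsIn_mono (fun w hw => ?_) hP
    change BeadLT (affineAt 0 w) _
    rw [affineAt_zero]
    exact hw.affineShift
  | succ m ih =>
    obtain ⟨τ, c', hc', h0, hgt, hlt, haff, hmem⟩ := ih (by omega)
    let i : Fin n := ⟨m, by omega⟩
    have hi : (⟨m, by omega⟩ : Fin (n + 1)) = i.castSucc := rfl
    have hi' : (⟨m + 1, hm⟩ : Fin (n + 1)) = i.succ := rfl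
    have htake : (List.finRange n).take (m + 1) = (List.finRange n).take m ++ [i] := by
      rw [List.take_succ_eq_append_getElem (by simpa using Nat.lt_of_succ_lt_succ hm),
        List.getElem_finRange]
      rfl
    rw [hi] at h0 haff hmem
    rw [hi', htake, List.foldl_append, List.foldl_cons, List.foldl_nil]
    have hs1 : τ i.succ = i.succ := hgt _ (by simp [i])
    -- The coefficient of the leading term is multiplied by `T_i⁻¹` or by a multiple of `T_i`,
    -- according to whether the length of the permutation increases or decreases.
    obtain ⟨c'', hc'', he⟩ : ∃ c'' : K, c'' ≠ 0 ∧
        (if (v ∘ τ) i.castSucc < (v ∘ τ) i.succ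
          then s⁻¹ • heckeT μ s i (c' • heckePermInv μ s (rankPerm v * τ) e)
          else heckeTInv μ s i (c' • heckePermInv μ s (rankPerm v * τ) e)) =
        c'' • heckePermInv μ s (rankPerm v * (τ * simple i)) e := by
      have hr := rankPerm_lt_iff v i.succ 0
      have hr' := rankPerm_lt_iff v 0 i.succ
      have hpos : (0 : Fin (n + 1)) < i.succ := Fin.succ_pos i
      simp only [hpos, hpos.not_gt, true_and, false_and, or_false, false_or] at hr hr'
      simp only [Function.comp_apply, h0, hs1, ← mul_assoc]
      split_ifs with h
      · refine ⟨s⁻¹ * c', mul_ne_zero (inv_ne_zero hs0) hc', ?_⟩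
        rw [map_smul, smul_smul, heckeT_heckePermInv hs0 hs]
        simpa [h0, hs1] using hr'.mpr h
      · refine ⟨c', hc', ?_⟩
        rw [map_smul, heckePermInv_mul_simple hs0 hs]
        simpa [h0, hs1] using hr.mpr (not_lt.mp h)
    refine ⟨τ * simple i, c'', hc'', ?_, ?_, ?_, ?_, ?_⟩
    · simp [simple_succ, h0]
    · intro j hj
      have h1 : j ≠ i.castSucc := by rintro rfl; simp [i] at hj
      have h2 : j ≠ i.succ := by rintro rfl; simp [i] at hj
      rw [Equiv.Perm.mul_apply, simple_of_ne h1 h2, hgt j (by omega)]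
    · intro j hj
      rw [Equiv.Perm.mul_apply]
      rcases Nat.lt_succ_iff_lt_or_eq.mp hj with hj | hj
      · have h1 : j.castSucc ≠ i.castSucc := by simp [i, Fin.ext_iff]; omega
        have h2 : j.castSucc ≠ i.succ := by simp [i, Fin.ext_iff]; omega
        rw [simple_of_ne h1 h2, hlt j hj]
      · obtain rfl : j = i := Fin.ext hj
        rw [simple_castSucc, hs1]
    · rw [Equiv.Perm.coe_mul, ← Function.comp_assoc, affineAt_succ_comp_simple, haff]
    · have h1 := boldTInv_mem_of_mem (s := s) hmem
      have h2 := boldTInv_tmul_sub_mem (s := s) i (v ∘ τ)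
        (c' • heckePermInv μ s (rankPerm v * τ) e)
      rw [he, haff] at h2
      rw [map_sub] at h1
      have h3 := Submodule.add_mem _ h1 h2
      rwa [sub_add_sub_cancel] at h3

theorem mulLeft_X_last_expMonomial (a : Fin (n + 1) → ℕ) :
    X (Fin.last n) * expMonomial K a = expMonomial K (affineAt (Fin.last n) a) := by
  rw [expMonomial, expMonomial, X, monomial_mul, one_mul]
  refine congrArg (fun e => monomial e (1 : K)) ?_
  ext j
  simp only [Finsupp.add_apply, Finsupp.equivFunOnFinite_symm_apply_apply, Finsupp.single_apply]
  induction j using Fin.lastCases with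
  | last => rw [affineAt_last_apply, if_pos rfl, add_comm]
  | cast j => rw [affineAt_castSucc, if_neg (Fin.castSucc_lt_last j).ne', zero_add,
      Fin.succAbove_last]

/-- The raising operator moves leading terms by the affine move. -/
theorem raising_leading {s : K} (hs0 : s ≠ 0) (hs : ∀ k : ℕ, 0 < k → s ^ k ≠ 1)
    {v : Fin (n + 1) → ℕ} {e : V K μ n} {P : M K μ n} {c : K} (hc : c ≠ 0)
    (hP : P - expMonomial K v ⊗ₜ (c • heckePermInv μ s (rankPerm v) e) ∈
      exponentsIn K μ {w | BeadLT w v}) :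
    ∃ c' : K, c' ≠ 0 ∧ raising μ s P - expMonomial K (affineShift v) ⊗ₜ
        (c' • heckePermInv μ s (rankPerm (affineShift v)) e) ∈
      exponentsIn K μ {w | BeadLT w (affineShift v)} := by
  obtain ⟨τ, c', hc', h0, -, hlt, haff, hmem⟩ := foldl_boldTInv_leading hs0 hs hc hP n (by omega)
  rw [List.take_of_length_le (by simp)] at hmem
  have hτ : τ = finRotate (n + 1) := by
    ext j
    induction j using Fin.lastCases with
    | last => rw [finRotate_last]; exact congrArg _ h0
    | cast j => rw [finRotate_castSucc, hlt j j.2]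
  refine ⟨c', hc', ?_⟩
  have hlast : ∀ (a : Fin (n + 1) → ℕ) (u : V K μ n),
      TensorProduct.map (LinearMap.mulLeft K (X (Fin.last n))) LinearMap.id
        (expMonomial K a ⊗ₜ[K] u) = expMonomial K (affineAt (Fin.last n) a) ⊗ₜ u := by
    intro a u
    rw [TensorProduct.map_tmul, LinearMap.mulLeft_apply, mulLeft_X_last_expMonomial,
      LinearMap.id_apply]
  have h1 := map_mem_of_mem_exponentsIn
    (TensorProduct.map (LinearMap.mulLeft K (X (Fin.last n))) LinearMap.id)
    (W := exponentsIn K μ {w | BeadLT w (affineShift v)}) (fun w hw u => by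
      rw [hlast]
      exact tmul_mem_exponentsIn (S := {w | BeadLT w (affineShift v)}) hw u) hmem
  rw [map_sub, hlast, rankPerm_affineShift v, ← hτ] at *
  rwa [show affineAt (Fin.last n) (v ∘ τ) = affineShift v from haff] at h1

end Raising

/-! ### Leading terms along paths -/

section Leading

variable {K : Type*} [Field K] {μ : YoungDiagram} {n : ℕ}

/-- The leading term of `P` is `x^{v,𝕋}`, up to a nonzero scalar, in the order of bead diagrams. -/
def HasBeadLeading (s : K) (P : M K μ n) (v : Fin (n + 1) → ℕ) (T : RST μ n) : Prop :=
  ∃ c : K, c ≠ 0 ∧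
    P - expMonomial K v ⊗ₜ (c • heckePermInv μ s (rankPerm v) (Finsupp.single T 1)) ∈
      exponentsIn K μ {w | BeadLT w v}

theorem HasBeadLeading.hasLeadingMonomial {s : K} (hs0 : s ≠ 0)
    (hs : ∀ k : ℕ, 0 < k → s ^ k ≠ 1) {P : M K μ n} {v : Fin (n + 1) → ℕ} {T : RST μ n}
    (h : HasBeadLeading s P v T) : HasLeadingMonomial s P v T := by
  obtain ⟨c, hc, hP⟩ := h
  refine ⟨c, hc, ?_⟩
  rw [vvMonomial, heckeR_eq, ← TensorProduct.tmul_smul]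
  refine (Submodule.span_le.mpr ?_ : exponentsIn K μ {w | BeadLT w v} ≤ _) hP
  rintro _ ⟨w, hw, u, rfl⟩
  obtain ⟨u, rfl⟩ := heckePermInv_surjective (μ := μ) hs0 hs (rankPerm w) u
  rw [SetLike.mem_coe]
  induction u using Finsupp.induction_linear with
  | zero => rw [map_zero, TensorProduct.tmul_zero]; exact Submodule.zero_mem _
  | add u u' hu hu' =>
    rw [map_add, TensorProduct.tmul_add]
    exact Submodule.add_mem _ hu hu'
  | single T' a =>
    rw [← mul_one a, ← smul_eq_mul, ← Finsupp.smul_single, map_smul, TensorProduct.tmul_smul,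
      ← heckeR_eq]
    exact Submodule.smul_mem _ _ (Submodule.subset_span ⟨w, T', hw.vecLT, rfl⟩)

/-- A step or jump moves the leading term from `v` to `v s_i`, with `T_i` acting on the tableau. -/
theorem edgeOp_sub_mem (s : K) (ζ : Fin (n + 1) → K) {i : Fin n} {v : Fin (n + 1) → ℕ}
    (h : v i.castSucc ≤ v i.succ) {P : M K μ n} {u : V K μ n}
    (hP : P - expMonomial K v ⊗ₜ u ∈ exponentsIn K μ {w | BeadLT w v}) :
    edgeOp s ζ i P - (expMonomial K (v ∘ simple i) ⊗ₜ heckeT μ s i u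
        + ((1 - s) / (1 - ζ i.succ / ζ i.castSucc)) • expMonomial K v ⊗ₜ u) ∈
      exponentsIn K μ {w | BeadLT w (v ∘ simple i)} := by
  have hle := beadLE_comp_simple h
  have h1 := boldT_mem_of_mem s h hP
  have h2 := Submodule.smul_mem _ ((1 - s) / (1 - ζ i.succ / ζ i.castSucc))
    (exponentsIn_mono (fun w (hw : BeadLT w v) => hw.trans_le hle) hP)
  rw [map_sub] at h1
  have h3 : boldT μ s i (expMonomial K v ⊗ₜ u) - expMonomial K (v ∘ simple i) ⊗ₜ heckeT μ s i u ∈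
      exponentsIn K μ {w | BeadLT w (v ∘ simple i)} := by
    rcases h.lt_or_eq with h | h
    · refine exponentsIn_mono ?_ (boldT_tmul_sub_mem s h.le u)
      have hne : v ≠ v ∘ simple i := fun heq => by
        have := congrFun heq i.castSucc
        rw [Function.comp_apply, simple_castSucc] at this
        omega
      rintro w (rfl | hw)
      · exact ⟨hle, hne⟩
      · refine ⟨sortPair_of_le h.le ▸ interiorPairs_beadLE hw, fun heq => ?_⟩
        have h4 := hw.2.2.2
        rw [heq, Function.comp_apply, simple_castSucc, max_eq_right h.le] at h4
        exact lt_irrefl _ h4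
    · rw [boldT_tmul, delta_of_eq s h, TensorProduct.zero_tmul, zero_add, sub_self]
      exact Submodule.zero_mem _
  have h4 := Submodule.add_mem _ (Submodule.add_mem _ h1 h3) h2
  rw [edgeOp]
  convert h4 using 1
  module

theorem HasBeadLeading.step {s : K} (hs0 : s ≠ 0) (hs : ∀ k : ℕ, 0 < k → s ^ k ≠ 1)
    {P : M K μ n} {v : Fin (n + 1) → ℕ} {T : RST μ n} (hP : HasBeadLeading s P v T)
    (ζ : Fin (n + 1) → K) {i : Fin n} (h : v i.castSucc < v i.succ) :
    HasBeadLeading s (edgeOp s ζ i P) (v ∘ simple i) T := by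
  obtain ⟨c, hc, hP⟩ := hP
  refine ⟨c, hc, ?_⟩
  have h1 := edgeOp_sub_mem s ζ h.le hP
  have hlt : v ∈ {w | BeadLT w (v ∘ simple i)} := by
    refine ⟨beadLE_comp_simple h.le, fun heq => ?_⟩
    have := congrFun heq i.castSucc
    rw [Function.comp_apply, simple_castSucc] at this
    omega
  have h2 := Submodule.smul_mem _ ((1 - s) / (1 - ζ i.succ / ζ i.castSucc))
    (tmul_mem_exponentsIn (K := K) (μ := μ) hlt
      (c • heckePermInv μ s (rankPerm v) (Finsupp.single T 1)))
  rw [rankPerm_comp_simple v h.ne, ← heckeT_heckePermInv hs0 hs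
    ((rankPerm_succ_lt_castSucc v).mpr h), ← map_smul]
  have h3 := Submodule.add_mem _ h1 h2
  rwa [← sub_sub, sub_add_cancel] at h3

end Leading

namespace RST

variable {μ : YoungDiagram} {n : ℕ}

/-- If the entry `j` has a larger content than `j + 1`, then it lies strictly above it: otherwise
some entry would lie strictly between them. -/
theorem row_lt_of_content_lt (T : RST μ n) {j : Fin n}
    (h : T.content j.succ + 2 ≤ T.content j.castSucc) : T.row j.castSucc < T.row j.succ := by
  simp only [content] at h
  by_contra! hr
  obtain ⟨m, hm1, hm2⟩ := T.exists_entry j.castSucc (c := T.col j.succ + 1) hr (by omega)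
  have h1 := T.lt_of_row_eq (k := j.succ) (l := m) (by omega) (by omega)
  have h2 := T.le_of_row_le_of_col_le (k := m) (l := j.castSucc) (by omega) (by omega)
  have h3 : m ≠ j.castSucc := by rintro rfl; omega
  rw [ne_eq, Fin.ext_iff] at h3
  simp only [Fin.lt_def, Fin.le_def, Fin.val_castSucc, Fin.val_succ] at h1 h2 h3
  omega

end RST

section Jump

variable {K : Type*} [Field K] {μ : YoungDiagram} {n : ℕ}

theorem heckeT_add_of_content_lt (s : K) {j : Fin n} {T T' : RST μ n}
    (h : T.content j.succ + 2 ≤ T.content j.castSucc)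
    (hT' : T'.1 = T.swapFilling j.castSucc j.succ) :
    heckeT μ s j (Finsupp.single T 1)
        + ((1 - s) / (1 - s ^ (T.content j.succ - T.content j.castSucc))) • Finsupp.single T 1 =
      Finsupp.single T' 1 := by
  have hr := T.row_lt_of_content_lt h
  have hc : T.col j.castSucc ≠ T.col j.succ := fun hc =>
    absurd (T.content_of_col_eq hc).2 hr.not_gt
  obtain rfl : T' = ⟨_, T.isRST_swapFilling j hr.ne hc⟩ := Subtype.ext hT'
  have h1 : heckeT μ s j (Finsupp.single T 1) = tableauT s j T := by simp [heckeT]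
  rw [h1, tableauT, dif_neg hr.ne, dif_neg hc]
  simp only [if_pos hr]
  rw [sub_add_cancel]

theorem HasBeadLeading.jump {s : K} (hs0 : s ≠ 0) (hs : ∀ k : ℕ, 0 < k → s ^ k ≠ 1)
    {P : M K μ n} {v : Fin (n + 1) → ℕ} {T T' : RST μ n} (hP : HasBeadLeading s P v T)
    {ζ : Fin (n + 1) → K} {i : Fin n} (h : v i.castSucc = v i.succ)
    (hc : T.content (rankPerm v i.succ) + 2 ≤ T.content (rankPerm v i.castSucc))
    (hT' : T'.1 = T.swapFilling (rankPerm v i.castSucc) (rankPerm v i.succ))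
    (hζ : ζ i.succ / ζ i.castSucc =
      s ^ (T.content (rankPerm v i.succ) - T.content (rankPerm v i.castSucc))) :
    HasBeadLeading s (edgeOp s ζ i P) v T' := by
  obtain ⟨c, hc0, hP⟩ := hP
  refine ⟨c, hc0, ?_⟩
  have hval := rankPerm_succ_of_eq v h
  let j : Fin n := ⟨rankPerm v i.castSucc, by have := (rankPerm v i.succ).2; omega⟩
  have hj1 : rankPerm v i.castSucc = j.castSucc := rfl
  have hj2 : rankPerm v i.succ = j.succ := Fin.ext hval
  have h1 := edgeOp_sub_mem s ζ h.le hP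
  rw [hj1, hj2] at hc hT' hζ
  rw [comp_simple_of_eq h, hζ] at h1
  rw [← heckeT_add_of_content_lt s hc hT', map_add, ← heckeT_heckePermInv_comm hs0 hs hj1 hj2,
    smul_add, TensorProduct.tmul_add, map_smul (heckePermInv μ s (rankPerm v)), smul_comm c,
    ← map_smul (heckeT μ s i), TensorProduct.tmul_smul]
  exact h1

end Jump

section Path

variable {K : Type*} [Field K] {μ : YoungDiagram} {n : ℕ}

/-- Along a path, the permutation is the rank permutation, the spectral vector is determined by the
other labels, and the leading term is the expected one. -/
theorem PathPolynomial.invariants {q s : K} (hq0 : q ≠ 0) (hs0 : s ≠ 0)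
    (hs : ∀ k : ℕ, 0 < k → s ^ k ≠ 1) {A : Vertex K μ n} {P : M K μ n}
    (hP : PathPolynomial q s A P) :
    A.σ = rankPerm A.v ∧ (∀ j, A.ζ j = q ^ A.v j * s ^ A.T.content (A.σ j)) ∧
      HasBeadLeading s P A.v A.T := by
  induction hP with
  | root T hT =>
    refine ⟨rankPerm_zero.symm, fun j => by simp, 1, one_ne_zero, ?_⟩
    have h1 : expMonomial K (fun _ : Fin (n + 1) => 0) = 1 := by
      have : Finsupp.equivFunOnFinite.symm (fun _ : Fin (n + 1) => 0) = 0 := by ext; rfl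
      rw [expMonomial, this]
      rfl
    rw [rankPerm_zero, heckePermInv_one hs0 hs, one_smul, h1, sub_self]
    exact Submodule.zero_mem _
  | step A P _ i hv ih =>
    obtain ⟨ih1, ih2, ih3⟩ := ih
    refine ⟨?_, fun j => ?_, ih3.step hs0 hs A.ζ hv⟩
    · simp only [rankPerm_comp_simple A.v hv.ne, ih1]
    · simp [ih2]
  | jump A P _ i hv hlt hse T' hT' ih =>
    obtain ⟨ih1, ih2, ih3⟩ := ih
    refine ⟨ih1, fun j => ?_, ?_⟩
    · have h1 : T'.content (A.σ j) = A.T.content (A.σ (simple i j)) := by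
        have h2 : T'.1.symm (A.σ j) = A.T.1.symm (A.σ (simple i j)) := by
          rw [hT', RST.swapFilling, Equiv.symm_trans_apply, Equiv.symm_swap, simple,
            ← Equiv.Perm.mul_apply A.σ, Equiv.mul_swap_eq_swap_mul]
          rfl
        simp only [RST.content, RST.row, RST.col, h2]
      have h3 : A.v (simple i j) = A.v j := congrFun (comp_simple_of_eq hv) j
      simp [ih2, h1, h3]
    · rw [ih1] at hse hT'
      refine ih3.jump hs0 hs hv hse hT' ?_
      rw [ih2, ih2, hv, ih1, mul_div_mul_left _ _ (pow_ne_zero _ hq0), zpow_sub₀ hs0]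
  | affine A P _ ih =>
    obtain ⟨ih1, ih2, c, hc, ih3⟩ := ih
    refine ⟨?_, fun j => ?_, raising_leading hs0 hs hc ih3⟩
    · simp only [ih1]
      exact (rankPerm_affineShift A.v).symm
    · induction j using Fin.lastCases with
      | last => simp [shift, ih2, pow_succ']; ring
      | cast j => simp [shift, ih2]

end Path

/-! ### Existence of paths -/

section Existence

variable {K : Type*} [Field K] {μ : YoungDiagram} {n : ℕ}

/-- Exchanging two adjacent values that are ordered like their weights decreases the weighted
sum. -/
theorem sum_mul_comp_simple_lt (c f : Fin (n + 1) → ℕ) {i : Fin n}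
    (h : (c i.castSucc < c i.succ ∧ f i.castSucc < f i.succ) ∨
      (c i.succ < c i.castSucc ∧ f i.succ < f i.castSucc)) :
    ∑ k, c k * f (simple i k) < ∑ k, c k * f k := by
  have hne : i.castSucc ≠ i.succ := i.castSucc_lt_succ.ne
  rw [sum_eq_add_add hne, sum_eq_add_add hne fun k => c k * f k, simple_castSucc, simple_succ,
    ← add_assoc, ← add_assoc]
  refine Nat.add_lt_add_of_lt_of_le ?_ (Finset.sum_le_sum fun k hk => ?_)
  · rcases h with ⟨h1, h2⟩ | ⟨h1, h2⟩ <;> nlinarith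
  · simp only [Finset.mem_erase] at hk
    rw [simple_of_ne hk.2.1 hk.1]

/-- If the columns do not increase when the entries decrease, the tableau is the root. -/
theorem RST.isRoot_of_antitone (T : RST μ n) (h : Antitone T.col) : T.IsRoot := by
  intro c d
  have e : ∀ c, (T.row (T.1 c) = c.1.1 ∧ T.col (T.1 c) = c.1.2) := fun c => by simp [row, col]
  rw [← (e c).1, ← (e c).2, ← (e d).1, ← (e d).2]
  generalize T.1 c = k
  generalize T.1 d = l
  constructor
  · intro hlk
    rcases (h hlk.le).lt_or_eq with h1 | h1
    · exact Or.inl h1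
    · refine Or.inr ⟨h1, ?_⟩
      by_contra! h2
      exact absurd (T.le_of_row_le_of_col_le h2 h1.ge) hlk.not_ge
  · rintro (h1 | ⟨h1, h2⟩)
    · exact lt_of_not_ge fun hkl => absurd (h hkl) h1.not_ge
    · exact T.lt_of_col_eq h1 h2

/-- With exponent `0`, every tableau is reached from the root by jumps. -/
theorem exists_path_zero (q s : K) (T : RST μ n) :
    ∃ ζ P, PathPolynomial q s ⟨T, ζ, fun _ => 0, 1⟩ P := by
  induction hm : ∑ k : Fin (n + 1), (k : ℕ) * T.col k using Nat.strong_induction_on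
    generalizing T with
  | _ m ih =>
  by_cases hcol : ∀ i : Fin n, T.col i.succ ≤ T.col i.castSucc
  · exact ⟨_, _, PathPolynomial.root T (T.isRoot_of_antitone (Fin.antitone_iff_succ_le.mpr hcol))⟩
  push Not at hcol
  obtain ⟨i, hi⟩ := hcol
  have hr : T.row i.succ < T.row i.castSucc := by
    by_contra! hr
    exact absurd (T.le_of_row_le_of_col_le hr hi.le) (not_le.mpr i.castSucc_lt_succ)
  let T' : RST μ n := ⟨T.swapFilling i.castSucc i.succ, T.isRST_swapFilling i hr.ne' hi.ne⟩
  have hsymm : ∀ k, T'.1.symm k = T.1.symm (simple i k) := fun k => rfl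
  have hT'col : ∀ k, T'.col k = T.col (simple i k) := fun k => by rw [RST.col, hsymm]; rfl
  have hT'row : ∀ k, T'.row k = T.row (simple i k) := fun k => by rw [RST.row, hsymm]; rfl
  obtain ⟨ζ, P, hP⟩ := ih (∑ k : Fin (n + 1), (k : ℕ) * T'.col k) (by
    simp only [hT'col, ← hm]
    exact sum_mul_comp_simple_lt (fun k => (k : ℕ)) T.col (Or.inl ⟨by simp, hi⟩)) T' rfl
  refine ⟨_, _, hP.jump _ _ i rfl i.castSucc_lt_succ ?_ T ?_⟩
  · simp only [Equiv.Perm.one_apply, RST.content, hT'col, hT'row, simple_castSucc, simple_succ]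
    omega
  · ext c
    simp [RST.swapFilling, T']

theorem exists_path (q s : K) (T : RST μ n) (v : Fin (n + 1) → ℕ) :
    ∃ ζ σ P, PathPolynomial q s ⟨T, ζ, v, σ⟩ P := by
  induction hN : ∑ j, v j generalizing v with
  | zero =>
    obtain rfl : v = fun _ => 0 := by
      funext j
      exact Finset.sum_eq_zero_iff.mp hN j (Finset.mem_univ j)
    obtain ⟨ζ, P, hP⟩ := exists_path_zero q s T
    exact ⟨ζ, 1, P, hP⟩
  | succ N ih =>
    induction hm : ∑ j : Fin (n + 1), (n - j : ℕ) * v j using Nat.strong_induction_on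
      generalizing v with
    | _ m ih' =>
    rcases Nat.eq_zero_or_pos (v (Fin.last n)) with hlast | hlast
    · -- The last entry is zero: undo a step that moved a larger entry to the left.
      obtain ⟨i, hi⟩ : ∃ i : Fin n, v i.succ < v i.castSucc := by
        by_contra! h
        have hmono : Monotone v := Fin.monotone_iff_le_succ.mpr h
        rw [Finset.sum_eq_zero fun j _ => Nat.eq_zero_of_le_zero
          ((hmono (Fin.le_last j)).trans_eq hlast)] at hN
        omega
      obtain ⟨ζ, σ, P, hP⟩ := ih' _ (by
        rw [← hm]
        exact sum_mul_comp_simple_lt (fun j => n - (j : ℕ)) v (Or.inr ⟨by simp; omega, hi⟩))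
        (v ∘ simple i) ((sum_comp_simple v i).trans hN) rfl
      have h1 := hP.step _ _ i (by simpa [simple_castSucc, simple_succ] using hi)
      simp only [comp_simple_comp_simple] at h1
      exact ⟨_, _, _, h1⟩
    · -- The last entry is positive: undo an affine step.
      let w : Fin (n + 1) → ℕ := Fin.cons (v (Fin.last n) - 1) fun j => v j.castSucc
      have hw : affineShift w = v := by
        funext j
        induction j using Fin.lastCases with
        | last => rw [affineShift_last]; simp [w]; omega
        | cast j => rw [affineShift_castSucc]; simp [w]
      have hsum := sum_affineShift w
      rw [hw, hN] at hsum
      obtain ⟨ζ, σ, P, hP⟩ := ih w (by omega)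
      have h1 := hP.affine
      rw [show shift w (w 0 + 1) = v from hw] at h1
      exact ⟨_, _, _, h1⟩

end Existence

end VVMacdonald
end

theorem mainTheorem5 {K : Type*} [Field K] [CharZero K] (q s : K)
    (hqs : AlgebraicIndependent ℚ ![q, s])
    (n : ℕ) (μ : YoungDiagram) (hμ : μ.card = n + 1)
    (v : Fin (n + 1) → ℕ) (T : VVMacdonald.RST μ n) :
    (∃ P : VVMacdonald.M K μ n, VVMacdonald.IsMacdonald q s v T P) ∧
      ∀ P : VVMacdonald.M K μ n, VVMacdonald.IsMacdonald q s v T P →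
        VVMacdonald.HasLeadingMonomial s P v T := by
  have hq : Transcendental ℚ q := hqs.transcendental 0
  have hst : Transcendental ℚ s := hqs.transcendental 1
  have hq0 : q ≠ 0 := fun h => hq (h ▸ isAlgebraic_zero)
  have hs0 : s ≠ 0 := fun h => hst (h ▸ isAlgebraic_zero)
  have hs : ∀ k : ℕ, 0 < k → s ^ k ≠ 1 := fun k hk h =>
    hst (IsAlgebraic.of_pow hk (h ▸ isAlgebraic_one))
  constructor
  · obtain ⟨ζ, σ, P, hP⟩ := VVMacdonald.exists_path q s T v
    exact ⟨P, ζ, σ, hP⟩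
  · rintro P ⟨ζ, σ, hP⟩
    exact (hP.invariants hq0 hs0 hs).2.2.hasLeadingMonomial hs0 hs
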